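/- Let $\Delta=\{z\in\mathbb C:|z|<1\}$. A continuous function $f$ on a circle $\Gamma$ is said to extend holomorphically from $\Gamma$ if there is a continuous function on the closed disc bounded by $\Gamma$ that is holomorphic in the open disc and equals $f$ on $\Gamma$. **Theorem 5.1.** Let $f:\overline\Delta\to\mathbb C$ be continuous, and let $p\in\mathbb C$ with $|p|=1$, $0<r<1$ and $0<\rho<1$. Assume that (i) $f$ extends holomorphically from each circle $\{|z|=R\}$ with $r\le R\le 1$; (ii) $f$ extends holomorphically from each circle of radius $R$ with $\rho\le R\le 1$ that passes through $p$ and is contained in $\overline\Delta$. If the smallest circles of the two families lie outside each other, that is, if the closed discs bounded by them, $\{|z|\le r\}$ and $\{|z-(1-\rho)p|\le\rho\}$, are disjoint, then $f$ is holomorphic on $\Delta$. -/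

import Mathlib

/-- `f` extends holomorphically from the circle with center `a` and radius `R`, that is, through
the disc bounded by it: some `g`, continuous on the closed disc and holomorphic on the open disc,
agrees with `f` on the circle. -/
def ExtendsHolomorphicallyFromCircle (f : ℂ → ℂ) (a : ℂ) (R : ℝ) : Prop :=
  ∃ g : ℂ → ℂ, ContinuousOn g (Metric.closedBall a R) ∧
    DifferentiableOn ℂ g (Metric.ball a R) ∧
    Set.EqOn g f (Metric.sphere a R)

open Complex MeasureTheory Set Metric Filter Topology

/-! After a rotation `p = 1`, and disjointness of the discs means `r < 1 - 2ρ`. On the circle `|z|²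
= t` one has `conj z = t / z`; on the circle of radius `1 / t` tangent at `1` one has `1 / (1 - z) +
1 / (1 - conj z) = t`. Replacing `conj z` by an independent variable `w` lifts each disc to a
complex curve, and the extensions become a function `F(z, w)` with `F(z, conj z) = f z`. For fixed
nonreal `z` in the strip `r < Re z < 1 - 2ρ`, `|z| < 1`, each family gives a path of `w` from `conj
z` to `1 / z`. The values of `F` on the two paths match at both ends; at `1 / z` both are the
extension through the unit disc.

Integrate `F(z, w) ω_k`, with `ω_k = (w - i)^k / (w + i)^(k+2) dw`, along both paths, for `Im z < 0`
so that the pole `-i` is avoided. At fixed `t` the integrand is holomorphic in `z`, so the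
`∂̄`-derivative of each integral comes only from the moving endpoint `w = conj z`, where it is the
same for both families. The difference of the integrals is therefore holomorphic
(`wedgeIntegral_shrinking_family` makes this precise, as `F` is only continuous up to the boundary).
On `|z| = 1` both paths degenerate to a point, so the difference vanishes on an arc, hence
identically (`eqOn_zero_of_eqOn_zero_arc`), and by continuity also at real `z = x`
(`IsExtensionPair.moments_eq`).

At `z = x` the two paths together run once around the real projective line. With `w = tan α`, `ω_k`
becomes `± e^{2i(k+1)α} dα`, so the Fourier coefficients of `F(x, ·)` on one side of zero vanish;
the reflected function `conj (f (conj z))` takes care of the other side. Thus `F(x, ·)` is constant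
(`IsExtensionPair.const_on_real`). Each extension then agrees with the one through the unit disc on
a real interval, hence throughout its disc, and the circles cover the open unit disc. -/

/-! ### Integrals depending on a complex parameter, with a moving endpoint -/

theorem continuousOn_intervalIntegral_of_continuousOn {X : Type*} [TopologicalSpace X] {s : Set X}
    {h : X → ℝ → ℂ} {a b : ℝ} (hc : ContinuousOn (Function.uncurry h) (s ×ˢ uIcc a b)) :
    ContinuousOn (fun x => ∫ t in a..b, h x t) s := by
  rw [continuousOn_iff_continuous_domRestrict]
  -- Clamping `t` to the interval makes the integrand continuous for all real `t` without changing
  -- the integral.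
  have key : Continuous (Function.uncurry fun (x : s) (t : ℝ) =>
      h x (projIcc (min a b) (max a b) min_le_max t)) := by
    refine hc.comp_continuous (f := fun q : s × ℝ =>
      ((q.1 : X), ((projIcc (min a b) (max a b) min_le_max q.2 : Icc _ _) : ℝ))) ?_ ?_
    · exact (continuous_subtype_val.comp continuous_fst).prodMk
        (continuous_subtype_val.comp (continuous_projIcc.comp continuous_snd))
    · rintro ⟨x, t⟩
      exact ⟨x.2, (projIcc (min a b) (max a b) min_le_max t).2⟩
  refine (intervalIntegral.continuous_parametric_intervalIntegral_of_continuous'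
    (μ := volume) key a b).congr ?_
  intro x
  refine intervalIntegral.integral_congr fun t ht => ?_
  simp only [projIcc_of_mem min_le_max (show t ∈ Icc (min a b) (max a b) from ht)]

theorem continuousOn_intervalIntegral_of_continuousOn_lower {X : Type*} [TopologicalSpace X]
    {s : Set X} {h : X → ℝ → ℂ} {τ : X → ℝ} {b : ℝ} (hτ : ContinuousOn τ s)
    (hc : ContinuousOn (Function.uncurry h) {q | q.1 ∈ s ∧ q.2 ∈ uIcc (τ q.1) b}) :
    ContinuousOn (fun x => ∫ t in (τ x)..b, h x t) s := by
  have h1 : ContinuousOn (fun x => (b - τ x) • ∫ u in (0 : ℝ)..1, h x (τ x + (b - τ x) * u)) s := by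
    refine (continuousOn_const.sub hτ).smul (continuousOn_intervalIntegral_of_continuousOn ?_)
    have hτ' : ContinuousOn (fun q : X × ℝ => τ q.1) (s ×ˢ uIcc (0 : ℝ) 1) :=
      hτ.comp continuousOn_fst fun q hq => hq.1
    refine hc.comp (f := fun q : X × ℝ => (q.1, τ q.1 + (b - τ q.1) * q.2)) ?_ ?_
    · exact continuousOn_fst.prodMk (hτ'.add ((continuousOn_const.sub hτ').mul continuousOn_snd))
    · rintro ⟨x, u⟩ ⟨hx, hu⟩
      refine ⟨hx, ?_⟩
      rw [uIcc_of_le zero_le_one] at hu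
      rw [← segment_eq_uIcc, segment_eq_image']
      exact ⟨u, hu, by simp [mul_comm]⟩
  refine h1.congr fun x _ => ?_
  simp [intervalIntegral.smul_integral_comp_add_mul (h x)]

/-- Morera and Fubini: rectangle integrals commute with the integral in `t`, so no bound on
derivatives is needed. -/
theorem differentiableOn_intervalIntegral {U : Set ℂ} (hU : IsOpen U) {h : ℂ → ℝ → ℂ} {a b : ℝ}
    (hc : ContinuousOn (Function.uncurry h) (U ×ˢ uIcc a b))
    (hd : ∀ t ∈ uIcc a b, DifferentiableOn ℂ (fun z => h z t) U) :
    DifferentiableOn ℂ (fun z => ∫ t in a..b, h z t) U := by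
  rw [← isConservativeOn_and_continuousOn_iff_isDifferentiableOn hU]
  refine ⟨fun z w hR => ?_, continuousOn_intervalIntegral_of_continuousOn hc⟩
  have swap : ∀ (c d : ℝ) (γ : ℝ → ℂ), Continuous γ → (∀ x ∈ uIcc c d, γ x ∈ U) →
      ∫ x in c..d, ∫ t in a..b, h (γ x) t = ∫ t in a..b, ∫ x in c..d, h (γ x) t ∧
      IntervalIntegrable (fun t => ∫ x in c..d, h (γ x) t) volume a b := by
    intro c d γ hγ hγU
    have hc' : ContinuousOn (Function.uncurry fun x t => h (γ x) t) (uIcc c d ×ˢ uIcc a b) :=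
      hc.comp (f := fun q : ℝ × ℝ => (γ q.1, q.2))
        ((hγ.comp continuous_fst).prodMk continuous_snd).continuousOn
        fun q hq => ⟨hγU _ hq.1, hq.2⟩
    refine ⟨intervalIntegral_intervalIntegral_swap ?_, ?_⟩
    · exact (hc'.integrableOn_compact (isCompact_uIcc.prod isCompact_uIcc)).mono_set
        (prod_mono uIoc_subset_uIcc uIoc_subset_uIcc)
    · refine (continuousOn_intervalIntegral_of_continuousOn (h := fun t x => h (γ x) t)
        ?_).intervalIntegrable
      exact hc'.comp (f := fun q : ℝ × ℝ => (q.2, q.1)) (by fun_prop) fun q hq => ⟨hq.2, hq.1⟩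
  have mem : ∀ x ∈ uIcc z.re w.re, ∀ y ∈ uIcc z.im w.im, (x + y * I : ℂ) ∈ U := fun x hx y hy =>
    hR (by simpa [Rectangle, mem_reProdIm] using And.intro hx hy)
  obtain ⟨e1, i1⟩ := swap z.re w.re (fun x => x + z.im * I) (by fun_prop)
    fun x hx => mem x hx _ left_mem_uIcc
  obtain ⟨e2, i2⟩ := swap z.re w.re (fun x => x + w.im * I) (by fun_prop)
    fun x hx => mem x hx _ right_mem_uIcc
  obtain ⟨e3, i3⟩ := swap z.im w.im (fun y => w.re + y * I) (by fun_prop)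
    fun y hy => mem _ right_mem_uIcc y hy
  obtain ⟨e4, i4⟩ := swap z.im w.im (fun y => z.re + y * I) (by fun_prop)
    fun y hy => mem _ left_mem_uIcc y hy
  have j3 : IntervalIntegrable (fun t => I • ∫ y in z.im..w.im, h (w.re + y * I) t) volume a b :=
    i3.smul I
  have j4 : IntervalIntegrable (fun t => I • ∫ y in z.im..w.im, h (z.re + y * I) t) volume a b :=
    i4.smul I
  rw [← add_eq_zero_iff_eq_neg, wedgeIntegral_add_wedgeIntegral_eq, e1, e2, e3, e4,
    ← intervalIntegral.integral_smul, ← intervalIntegral.integral_smul,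
    ← intervalIntegral.integral_sub i1 i2, ← intervalIntegral.integral_add (i1.sub i2) j3,
    ← intervalIntegral.integral_sub ((i1.sub i2).add j3) j4]
  refine (intervalIntegral.integral_congr fun t ht => ?_).trans intervalIntegral.integral_zero
  have := (hd t ht).isConservativeOn z w hR
  rwa [← add_eq_zero_iff_eq_neg, wedgeIntegral_add_wedgeIntegral_eq] at this

/-- Split the integral at `τ z₀`. The part with fixed limits is holomorphic and contributes the
complex linear map `c`; the short part is `(τ z - τ z₀) h z₀ (τ z₀)` up to a little-o. Only the
second term has a `∂̄`-component. -/
theorem hasFDerivAt_intervalIntegral_lower {S : Set ℂ} {z₀ : ℂ} (hS : S ∈ 𝓝 z₀) {J : Set ℝ}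
    {τ : ℂ → ℝ} {τ' : ℂ →L[ℝ] ℝ} {b : ℝ} (hτ : HasFDerivAt τ τ' z₀) (hJ : J ∈ 𝓝 (τ z₀))
    (hbJ : uIcc (τ z₀) b ⊆ J) {h : ℂ → ℝ → ℂ} (hc : ContinuousOn (Function.uncurry h) (S ×ˢ J))
    {U : Set ℂ} (hU : U ∈ 𝓝 z₀) (hd : ∀ t ∈ uIcc (τ z₀) b, DifferentiableOn ℂ (fun z => h z t) U) :
    ∃ c : ℂ, HasFDerivAt (fun z => ∫ t in (τ z)..b, h z t)
      ((ContinuousLinearMap.toSpanSingleton ℂ c).restrictScalars ℝ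
        - τ'.smulRight (h z₀ (τ z₀))) z₀ := by
  obtain ⟨V, hVsub, hVo, hzV⟩ := _root_.mem_nhds_iff.1 (inter_mem hS hU)
  have hVS : V ⊆ S := hVsub.trans inter_subset_left
  have hVU : V ⊆ U := hVsub.trans inter_subset_right
  have D : DifferentiableOn ℂ (fun z => ∫ t in (τ z₀)..b, h z t) V :=
    differentiableOn_intervalIntegral hVo (hc.mono (prod_mono hVS hbJ))
      fun t ht => (hd t ht).mono hVU
  have D0 := (D.differentiableAt (hVo.mem_nhds hzV)).hasDerivAt
  refine ⟨deriv (fun z => ∫ t in (τ z₀)..b, h z t) z₀, ?_⟩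
  have hsmall : HasFDerivAt (fun z => ∫ t in (τ z₀)..(τ z), h z t) (τ'.smulRight (h z₀ (τ z₀))) z₀ := by
    have hlin : HasFDerivAt (fun z => (τ z - τ z₀) • h z₀ (τ z₀)) (τ'.smulRight (h z₀ (τ z₀))) z₀ :=
      (hτ.sub_const _).smul_const _
    have hO := hτ.isBigO_sub
    rw [hasFDerivAt_iff_isLittleO] at hlin ⊢
    have hrem : (fun z => (∫ t in (τ z₀)..(τ z), h z t) - (τ z - τ z₀) • h z₀ (τ z₀)) =o[𝓝 z₀]
        fun z => z - z₀ := by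
      refine Asymptotics.IsLittleO.trans_isBigO (g := fun z => τ z - τ z₀) ?_ hO
      rw [Asymptotics.isLittleO_iff]
      intro ε hε
      have hcat : ContinuousAt (Function.uncurry h) (z₀, τ z₀) :=
        hc.continuousAt (prod_mem_nhds hS hJ)
      have h1 := Metric.tendsto_nhds.1 hcat ε hε
      rw [nhds_prod_eq] at h1
      obtain ⟨A, hA, B, hB, hAB⟩ := Filter.mem_prod_iff.1 (inter_mem h1 (prod_mem_prod hS hJ))
      obtain ⟨η, hη, hηB⟩ := Metric.mem_nhds_iff.1 hB
      filter_upwards [hA, hτ.continuousAt (Metric.ball_mem_nhds _ hη)] with z hzA hzη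
      have hsub : uIcc (τ z₀) (τ z) ⊆ B := by
        refine Subset.trans ?_ hηB
        rw [← segment_eq_uIcc]
        exact (convex_ball _ _).segment_subset (mem_ball_self hη) hzη
      have hcz : ContinuousOn (h z) (uIcc (τ z₀) (τ z)) :=
        hc.comp (f := fun t => (z, t)) (by fun_prop) fun t ht =>
          (hAB (mk_mem_prod hzA (hsub ht))).2
      have e : (∫ t in (τ z₀)..(τ z), h z t) - (τ z - τ z₀) • h z₀ (τ z₀) =
          ∫ t in (τ z₀)..(τ z), (h z t - h z₀ (τ z₀)) := by
        rw [intervalIntegral.integral_sub hcz.intervalIntegrable (by simp)]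
        simp
      rw [e, Real.norm_eq_abs]
      refine intervalIntegral.norm_integral_le_of_norm_le_const fun t ht => ?_
      have := (hAB (mk_mem_prod hzA (hsub (uIoc_subset_uIcc ht)))).1
      rw [mem_ofPred_eq, dist_eq_norm] at this
      exact this.le
    refine (hrem.add hlin).congr_left fun z => ?_
    simp
  have hD := (D0.hasFDerivAt.restrictScalars ℝ).sub hsmall
  refine hD.congr_of_eventuallyEq ?_
  obtain ⟨η, hη, hηJ⟩ := Metric.mem_nhds_iff.1 hJ
  filter_upwards [hS, hτ.continuousAt (Metric.ball_mem_nhds _ hη)] with z hzS hzη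
  have hsub : uIcc (τ z₀) (τ z) ⊆ J := by
    refine Subset.trans ?_ hηJ
    rw [← segment_eq_uIcc]
    exact (convex_ball _ _).segment_subset (mem_ball_self hη) hzη
  have hcz : ∀ s ⊆ J, ContinuousOn (h z) s := fun s hs =>
    hc.comp (f := fun t => (z, t)) (by fun_prop) fun t ht => ⟨hzS, hs ht⟩
  have := intervalIntegral.integral_add_adjacent_intervals
    (hcz _ hsub).intervalIntegrable.symm (hcz _ hbJ).intervalIntegrable (μ := volume)
  rw [Pi.sub_apply, ← this, intervalIntegral.integral_symm]
  ring

/-! ### Green's formula for integrals over a shrinking family of discs -/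

/-- Green's formula with `N = 2i ∂̄τ`: the area density records only the moving endpoint. The point
`ζ z t` may reach the unit circle, where `G t` need not be differentiable, so the formula is first
proved with `ζ` replaced by `(1 - ε) ζ`, and then `ε → 0`. -/
theorem wedgeIntegral_shrinking_family {S : Set ℂ} (hS : IsOpen S) {J : Set ℝ} {b : ℝ}
    {τ : ℂ → ℝ} {τ' : ℂ → ℂ →L[ℝ] ℝ} (hτ : ∀ z ∈ S, HasFDerivAt τ (τ' z) z)
    {N : ℂ → ℂ} (hN : ContinuousOn N S) (hNeq : ∀ z ∈ S, I * τ' z 1 - τ' z I = N z)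
    (hJ : ∀ z ∈ S, J ∈ 𝓝 (τ z)) (hbJ : ∀ z ∈ S, uIcc (τ z) b ⊆ J)
    {G : ℝ → ℂ → ℂ} (hG : Continuous (Function.uncurry G))
    (hGd : ∀ t ∈ J, DifferentiableOn ℂ (G t) (ball 0 1))
    {ζ k : ℂ → ℝ → ℂ} (hζ : ContinuousOn (Function.uncurry ζ) (S ×ˢ J))
    (hζd : ∀ t ∈ J, DifferentiableOn ℂ (fun z => ζ z t) S)
    (hk : ContinuousOn (Function.uncurry k) (S ×ˢ J))
    (hkd : ∀ t ∈ J, DifferentiableOn ℂ (fun z => k z t) S)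
    (hζ1 : ∀ z ∈ S, ∀ t ∈ uIcc (τ z) b, ‖ζ z t‖ ≤ 1)
    {z w : ℂ} (hR : Rectangle z w ⊆ S) :
    wedgeIntegral z w (fun z => ∫ t in (τ z)..b, G t (ζ z t) * k z t) +
      wedgeIntegral w z (fun z => ∫ t in (τ z)..b, G t (ζ z t) * k z t) =
    ∫ x in z.re..w.re, ∫ y in z.im..w.im,
      (fun z => - (G (τ z) (ζ z (τ z)) * k z (τ z) * N z)) (x + y * I) := by
  set h : ℝ × ℂ → ℝ → ℂ := fun q t => G t ((1 - q.1) * ζ q.2 t) * k q.2 t with hh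
  have hcont : ContinuousOn (Function.uncurry h) ((univ ×ˢ S) ×ˢ J) := by
    have hm : MapsTo (fun q : (ℝ × ℂ) × ℝ => (q.1.2, q.2)) ((univ ×ˢ S) ×ˢ J) (S ×ˢ J) :=
      fun q hq => ⟨hq.1.2, hq.2⟩
    have hζ' := hζ.comp (f := fun q : (ℝ × ℂ) × ℝ => (q.1.2, q.2)) (by fun_prop) hm
    have hk' := hk.comp (f := fun q : (ℝ × ℂ) × ℝ => (q.1.2, q.2)) (by fun_prop) hm
    refine ContinuousOn.mul ?_ hk'
    refine hG.comp_continuousOn (f := fun q : (ℝ × ℂ) × ℝ => (q.2, (1 - q.1.1) * ζ q.1.2 q.2)) ?_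
    exact continuousOn_snd.prodMk (ContinuousOn.mul (by fun_prop) hζ')
  have hτc : ContinuousOn τ S := fun z hz => (hτ z hz).continuousAt.continuousWithinAt
  have hτc' : ContinuousOn (fun q : ℝ × ℂ => τ q.2) (univ ×ˢ S) :=
    hτc.comp continuousOn_snd fun q hq => hq.2
  have Acont : ContinuousOn (fun q : ℝ × ℂ => ∫ t in (τ q.2)..b, h q t) (univ ×ˢ S) :=
    continuousOn_intervalIntegral_of_continuousOn_lower hτc'
      (hcont.mono fun q hq => ⟨hq.1, hbJ _ hq.1.2 hq.2⟩)
  have Dcont : ContinuousOn (fun q : ℝ × ℂ => - (h q (τ q.2) * N q.2)) (univ ×ˢ S) := by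
    refine ((hcont.comp (f := fun q : ℝ × ℂ => (q, τ q.2)) (continuousOn_id.prodMk hτc')
      fun q hq => ⟨hq, mem_of_mem_nhds (hJ _ hq.2)⟩).mul (hN.comp continuousOn_snd ?_)).neg
    exact fun q hq => hq.2
  have mem : ∀ x ∈ uIcc z.re w.re, ∀ y ∈ uIcc z.im w.im, (x + y * I : ℂ) ∈ S := fun x hx y hy =>
    hR (by simpa [Rectangle, mem_reProdIm] using And.intro hx hy)
  have slice : ∀ ε : ℝ, ∀ z ∈ S, (ε, z) ∈ (univ : Set ℝ) ×ˢ S := fun ε z hz => ⟨mem_univ _, hz⟩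
  have green : ∀ ε ∈ Ioo (0 : ℝ) 1,
      wedgeIntegral z w (fun z => ∫ t in (τ z)..b, h (ε, z) t) +
        wedgeIntegral w z (fun z => ∫ t in (τ z)..b, h (ε, z) t) =
      ∫ x in z.re..w.re, ∫ y in z.im..w.im, (fun z => - (h (ε, z) (τ z) * N z)) (x + y * I) := by
    intro ε hε
    have hFD : ∀ z ∈ S, ∃ c : ℂ, HasFDerivAt (fun z => ∫ t in (τ z)..b, h (ε, z) t)
        ((ContinuousLinearMap.toSpanSingleton ℂ c).restrictScalars ℝ
          - (τ' z).smulRight (h (ε, z) (τ z))) z := by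
      intro z₀ hz₀
      -- Compactness in `t` gives one neighbourhood of `z₀` on which all the contracted points stay
      -- in the open disc.
      have hU : {z | ∀ t ∈ uIcc (τ z₀) b, ‖(1 - ε) * ζ z t‖ < 1} ∈ 𝓝 z₀ := by
        have hev : ∀ᶠ z in 𝓝 z₀, ∀ t ∈ uIcc (τ z₀) b,
            ‖(1 - ε) * ζ z (projIcc (min (τ z₀) b) (max (τ z₀) b) min_le_max t)‖ < 1 := by
          refine isCompact_uIcc.eventually_forall_of_forall_eventually fun t ht => ?_
          have hca : ContinuousAt (fun q : ℂ × ℝ =>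
              ‖(1 - ε) * ζ q.1 (projIcc (min (τ z₀) b) (max (τ z₀) b) min_le_max q.2)‖) (z₀, t) := by
            have : ContinuousOn (fun q : ℂ × ℝ =>
                ζ q.1 (projIcc (min (τ z₀) b) (max (τ z₀) b) min_le_max q.2)) (S ×ˢ univ) :=
              hζ.comp (f := fun q : ℂ × ℝ =>
                (q.1, ((projIcc (min (τ z₀) b) (max (τ z₀) b) min_le_max q.2 : Icc _ _) : ℝ)))
                (by fun_prop) fun q hq => ⟨hq.1, hbJ z₀ hz₀ (projIcc _ _ min_le_max q.2).2⟩
            exact (continuousAt_const.mul (this.continuousAt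
              (prod_mem_nhds (hS.mem_nhds hz₀) univ_mem))).norm
          refine hca.eventually_lt continuousAt_const ?_
          simp only
          rw [norm_mul, projIcc_of_mem min_le_max (show t ∈ Icc (min _ _) (max _ _) from ht)]
          have e1 : ‖(1 - ε : ℂ)‖ = 1 - ε := by
            rw [← ofReal_one, ← ofReal_sub, norm_real, Real.norm_eq_abs, abs_of_pos (by linarith [hε.2])]
          rw [e1]
          have := hζ1 z₀ hz₀ t ht
          nlinarith [hε.1, hε.2, norm_nonneg (ζ z₀ t)]
        filter_upwards [hev] with z hz t ht
        have := hz t ht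
        rwa [projIcc_of_mem min_le_max (show t ∈ Icc (min _ _) (max _ _) from ht)] at this
      refine hasFDerivAt_intervalIntegral_lower (h := fun z t => h (ε, z) t) (hS.mem_nhds hz₀)
        (hτ z₀ hz₀) (hJ z₀ hz₀) (hbJ z₀ hz₀) ?_ (inter_mem (hS.mem_nhds hz₀) hU) ?_
      · exact hcont.comp (f := fun q : ℂ × ℝ => ((ε, q.1), q.2)) (by fun_prop)
          fun q hq => ⟨slice _ _ hq.1, hq.2⟩
      · intro t ht z hz
        have htJ := hbJ z₀ hz₀ ht
        have a1 := (hζd t htJ).differentiableAt (hS.mem_nhds hz.1)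
        have a2 := (hkd t htJ).differentiableAt (hS.mem_nhds hz.1)
        have a3 : DifferentiableAt ℂ (G t) ((1 - ε) * ζ z t) :=
          (hGd t htJ).differentiableAt (isOpen_ball.mem_nhds (by simpa using hz.2 t ht))
        exact ((a3.comp z (a1.const_mul (1 - ε : ℂ))).mul a2).differentiableWithinAt
    choose! c hc using hFD
    rw [wedgeIntegral_add_wedgeIntegral_eq]
    have hD : ∀ z ∈ S, I • ((ContinuousLinearMap.toSpanSingleton ℂ (c z)).restrictScalars ℝ
          - (τ' z).smulRight (h (ε, z) (τ z))) 1 -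
          ((ContinuousLinearMap.toSpanSingleton ℂ (c z)).restrictScalars ℝ
          - (τ' z).smulRight (h (ε, z) (τ z))) I = - (h (ε, z) (τ z) * N z) := by
      intro z hz
      rw [← hNeq z hz]
      simp
      ring
    refine (integral_boundary_rect_of_hasFDerivAt_real_off_countable
      (fun z => ∫ t in (τ z)..b, h (ε, z) t) (fun z =>
      (ContinuousLinearMap.toSpanSingleton ℂ (c z)).restrictScalars ℝ
          - (τ' z).smulRight (h (ε, z) (τ z))) z w ∅ countable_empty ?_ ?_ ?_).trans ?_
    · exact fun x hx => (hc x (hR hx)).continuousAt.continuousWithinAt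
    · rintro x ⟨hx, -⟩
      exact hc x (hR ⟨Ioo_subset_Icc_self hx.1, Ioo_subset_Icc_self hx.2⟩)
    · refine IntegrableOn.congr_fun (f := fun z => - (h (ε, z) (τ z) * N z)) ?_
        (fun z hz => (hD z (hR hz)).symm)
        (isCompact_uIcc.reProdIm isCompact_uIcc).measurableSet
      refine ContinuousOn.integrableOn_compact (isCompact_uIcc.reProdIm isCompact_uIcc) ?_
      exact Dcont.comp (f := fun z : ℂ => (ε, z)) (by fun_prop) fun z hz => slice _ _ (hR hz)
    · refine intervalIntegral.integral_congr fun x hx => intervalIntegral.integral_congr fun y hy => ?_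
      exact hD _ (mem x hx y hy)
  have line : ∀ (F : ℝ × ℂ → ℂ), ContinuousOn F (univ ×ˢ S) → ∀ (c d : ℝ) (γ : ℝ → ℂ), Continuous γ →
      (∀ x ∈ uIcc c d, γ x ∈ S) → Continuous (fun ε : ℝ => ∫ x in c..d, F (ε, γ x)) := by
    intro F hF c d γ hγ hγS
    rw [← continuousOn_univ]
    refine continuousOn_intervalIntegral_of_continuousOn (h := fun ε x => F (ε, γ x)) ?_
    exact hF.comp (f := fun q : ℝ × ℝ => (q.1, γ q.2)) (by fun_prop)
      fun q hq => slice _ _ (hγS _ hq.2)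
  have L : Continuous (fun ε : ℝ => wedgeIntegral z w (fun z => ∫ t in (τ z)..b, h (ε, z) t) +
        wedgeIntegral w z (fun z => ∫ t in (τ z)..b, h (ε, z) t)) := by
    simp only [wedgeIntegral_add_wedgeIntegral_eq]
    refine (((line _ Acont _ _ (fun x => x + z.im * I) (by fun_prop) ?_).sub
      (line _ Acont _ _ (fun x => x + w.im * I) (by fun_prop) ?_)).add
      ((line _ Acont _ _ (fun y => w.re + y * I) (by fun_prop) ?_).const_smul I)).sub
      ((line _ Acont _ _ (fun y => z.re + y * I) (by fun_prop) ?_).const_smul I)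
    · exact fun x hx => mem x hx _ left_mem_uIcc
    · exact fun x hx => mem x hx _ right_mem_uIcc
    · exact fun y hy => mem _ right_mem_uIcc y hy
    · exact fun y hy => mem _ left_mem_uIcc y hy
  have Rr : Continuous (fun ε : ℝ => ∫ x in z.re..w.re, ∫ y in z.im..w.im,
      (fun z => - (h (ε, z) (τ z) * N z)) (x + y * I)) := by
    rw [← continuousOn_univ]
    refine continuousOn_intervalIntegral_of_continuousOn (h := fun (ε x : ℝ) =>
      ∫ y in z.im..w.im, - (h (ε, x + y * I) (τ (x + y * I)) * N (x + y * I))) ?_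
    refine continuousOn_intervalIntegral_of_continuousOn (h := fun (q : ℝ × ℝ) (y : ℝ) =>
      - (h (q.1, q.2 + y * I) (τ (q.2 + y * I)) * N (q.2 + y * I))) ?_
    exact Dcont.comp (f := fun q : (ℝ × ℝ) × ℝ => (q.1.1, (q.1.2 + q.2 * I : ℂ))) (by fun_prop)
      fun q hq => slice _ _ (mem _ hq.1.2 _ hq.2)
  -- Both sides of the formula are continuous in `ε`, so it persists at `ε = 0`.
  have h0 : (0 : ℝ) ∈ closure (Ioo (0 : ℝ) 1) := by
    rw [closure_Ioo (by norm_num)]; simp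
  have := (isClosed_eq L Rr).closure_subset_iff.2 green h0
  simpa [hh] using this

/-! ### Joint continuity of the holomorphic extensions -/

/-- By the maximum principle the extensions for nearby parameters, rescaled to the unit disc, differ
by no more than their boundary values, and these are controlled by the uniform continuity of `f`. -/
theorem exists_continuous_family_of_extendsHolomorphicallyFromCircle {f : ℂ → ℂ}
    (hf : ContinuousOn f (closedBall 0 1)) {T : Set ℝ} (hT : IsClosed T) {c : ℝ → ℂ} {R : ℝ → ℝ}
    (hc : ContinuousOn c T) (hR : ContinuousOn R T) (hpos : ∀ t ∈ T, 0 < R t)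
    (hsub : ∀ t ∈ T, sphere (c t) (R t) ⊆ closedBall 0 1)
    (hext : ∀ t ∈ T, ExtendsHolomorphicallyFromCircle f (c t) (R t)) :
    ∃ G : ℝ → ℂ → ℂ, Continuous (Function.uncurry G) ∧ ∀ t ∈ T, DifferentiableOn ℂ (G t) (ball 0 1) ∧
      ∀ ζ ∈ sphere (0 : ℂ) 1, G t ζ = f (c t + R t * ζ) := by
  choose! g hgc hgd hgf using hext
  set G₀ : ℝ → ℂ → ℂ := fun t ζ => g t (c t + R t * ζ) with hG₀
  have maps : ∀ t ∈ T, MapsTo (fun ζ : ℂ => c t + R t * ζ) (closedBall 0 1) (closedBall (c t) (R t)) := by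
    intro t ht ζ hζ
    rw [mem_closedBall_zero_iff] at hζ
    have := hpos t ht
    simp only [mem_closedBall, dist_self_add_left, norm_mul, norm_real, Real.norm_eq_abs,
      abs_of_pos this]
    nlinarith
  have maps' : ∀ t ∈ T, MapsTo (fun ζ : ℂ => c t + R t * ζ) (ball 0 1) (ball (c t) (R t)) := by
    intro t ht ζ hζ
    rw [mem_ball_zero_iff] at hζ
    have := hpos t ht
    simp only [mem_ball, dist_self_add_left, norm_mul, norm_real, Real.norm_eq_abs,
      abs_of_pos this]
    nlinarith
  have mapsS : ∀ t ∈ T, MapsTo (fun ζ : ℂ => c t + R t * ζ) (sphere 0 1) (sphere (c t) (R t)) := by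
    intro t ht ζ hζ
    rw [mem_sphere_zero_iff_norm] at hζ
    have := hpos t ht
    simp [hζ, abs_of_pos this]
  have hcont : ∀ t ∈ T, ContinuousOn (G₀ t) (closedBall 0 1) := fun t ht =>
    (hgc t ht).comp (by fun_prop) (maps t ht)
  have hdiff : ∀ t ∈ T, DifferentiableOn ℂ (G₀ t) (ball 0 1) := fun t ht =>
    (hgd t ht).comp (by fun_prop) (maps' t ht)
  have hbd : ∀ t ∈ T, ∀ ζ ∈ sphere (0 : ℂ) 1, G₀ t ζ = f (c t + R t * ζ) := fun t ht ζ hζ =>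
    hgf t ht (mapsS t ht hζ)
  have huc : UniformContinuousOn f (closedBall 0 1) :=
    (isCompact_closedBall 0 1).uniformContinuousOn_of_continuous hf
  have hsup : ∀ t₀ ∈ T, ∀ ε > 0, ∀ᶠ t in 𝓝[T] t₀, ∀ ζ ∈ closedBall (0 : ℂ) 1,
      ‖G₀ t ζ - G₀ t₀ ζ‖ ≤ ε := by
    intro t₀ ht₀ ε hε
    obtain ⟨δ, hδ, hfδ⟩ := Metric.uniformContinuousOn_iff.1 huc ε hε
    filter_upwards [self_mem_nhdsWithin, Metric.tendsto_nhds.1 (hc t₀ ht₀) (δ / 2) (half_pos hδ),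
      Metric.tendsto_nhds.1 (hR t₀ ht₀) (δ / 2) (half_pos hδ)] with t ht hct hRt ζ hζ
    have hdc : DiffContOnCl ℂ (fun ζ => G₀ t ζ - G₀ t₀ ζ) (ball 0 1) := by
      refine ⟨(hdiff t ht).sub (hdiff t₀ ht₀), ?_⟩
      rw [closure_ball _ one_ne_zero]
      exact (hcont t ht).sub (hcont t₀ ht₀)
    refine norm_le_of_forall_mem_frontier_norm_le isBounded_ball hdc ?_
      (by rwa [closure_ball _ one_ne_zero])
    intro ξ hξ
    rw [frontier_ball _ one_ne_zero] at hξ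
    rw [hbd t ht ξ hξ, hbd t₀ ht₀ ξ hξ, ← dist_eq_norm]
    refine (hfδ _ (hsub t ht (mapsS t ht hξ)) _ (hsub t₀ ht₀ (mapsS t₀ ht₀ hξ)) ?_).le
    rw [dist_eq_norm] at hct hRt ⊢
    rw [mem_sphere_zero_iff_norm] at hξ
    calc ‖c t + R t * ξ - (c t₀ + R t₀ * ξ)‖ = ‖(c t - c t₀) + ((R t - R t₀ : ℝ) : ℂ) * ξ‖ := by
          congr 1; push_cast; ring
      _ ≤ ‖c t - c t₀‖ + ‖R t - R t₀‖ := by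
          refine (norm_add_le _ _).trans ?_
          rw [norm_mul, hξ, norm_real, mul_one]
      _ < δ := by linarith
  have hjoint : ContinuousOn (Function.uncurry G₀) (T ×ˢ closedBall 0 1) := by
    rintro ⟨t₀, ζ₀⟩ ⟨ht₀, hζ₀⟩
    rw [ContinuousWithinAt, Metric.tendsto_nhds]
    intro ε hε
    rw [nhdsWithin_prod_eq]
    filter_upwards [prod_mem_prod (hsup t₀ ht₀ (ε / 2) (half_pos hε)) (inter_mem self_mem_nhdsWithin
      (Metric.tendsto_nhds.1 (hcont t₀ ht₀ ζ₀ hζ₀) (ε / 2) (half_pos hε)))]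
    rintro ⟨t, ζ⟩ ⟨h1, h2, h3⟩
    have h1' := h1 ζ h2
    rw [← dist_eq_norm] at h1'
    calc dist (G₀ t ζ) (G₀ t₀ ζ₀) ≤ dist (G₀ t ζ) (G₀ t₀ ζ) + dist (G₀ t₀ ζ) (G₀ t₀ ζ₀) :=
          dist_triangle _ _ _
      _ < ε := by
          have : dist (G₀ t₀ ζ) (G₀ t₀ ζ₀) < ε / 2 := h3
          linarith
  -- Tietze extends the family continuously to all of `ℝ × ℂ`, so later arguments about continuity
  -- need not track the domain.
  obtain ⟨E, hE⟩ := ContinuousMap.exists_restrict_eq (hT.prod isClosed_closedBall)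
    ⟨_, continuousOn_iff_continuous_domRestrict.1 hjoint⟩
  have hEeq : ∀ t ∈ T, ∀ ζ ∈ closedBall (0 : ℂ) 1, E (t, ζ) = G₀ t ζ := fun t ht ζ hζ =>
    DFunLike.congr_fun hE ⟨(t, ζ), ht, hζ⟩
  refine ⟨fun t ζ => E (t, ζ), E.continuous, fun t ht => ⟨?_, ?_⟩⟩
  · exact (hdiff t ht).congr fun ζ hζ => hEeq t ht ζ (ball_subset_closedBall hζ)
  · exact fun ζ hζ => (hEeq t ht ζ (sphere_subset_closedBall hζ)).trans (hbd t ht ζ hζ)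

/-! ### Uniqueness from Fourier coefficients and from boundary values -/

/-- A continuous function on a period whose Fourier coefficients of non-zero order vanish is
constant. -/
theorem eq_of_integral_mul_exp_eq_zero {a : ℝ} {H : ℝ → ℂ} (hH : ContinuousOn H (Icc a (a + Real.pi)))
    (hper : H a = H (a + Real.pi))
    (hcoeff : ∀ n : ℤ, n ≠ 0 → ∫ x in a..(a + Real.pi), H x * exp (2 * n * x * I) = 0) :
    ∀ x ∈ Icc a (a + Real.pi), H x = H a := by
  have : Fact (0 < Real.pi) := ⟨Real.pi_pos⟩
  set F : C(AddCircle Real.pi, ℂ) := ⟨_, AddCircle.liftIco_continuous hper hH⟩ with hF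
  have hcoef : ∀ n : ℤ, n ≠ 0 → fourierCoeff F n = 0 := by
    intro n hn
    rw [hF, ContinuousMap.coe_mk, fourierCoeff_liftIco_eq, fourierCoeffOn_eq_integral]
    have := hcoeff (-n) (neg_ne_zero.2 hn)
    rw [smul_eq_zero]
    right
    rw [← this]
    refine intervalIntegral.integral_congr fun x _ => ?_
    simp only [smul_eq_mul]
    rw [mul_comm, add_sub_cancel_left, fourier_coe_apply]
    congr 2
    have : (Real.pi : ℂ) ≠ 0 := by exact_mod_cast Real.pi_ne_zero
    push_cast
    field_simp
  -- With one possibly nonzero coefficient the Fourier series is summable, hence converges pointwise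
  -- to `F`.
  have hs : Summable (fourierCoeff F) := summable_of_ne_finset_zero (s := {0}) fun n hn =>
    hcoef n (by simpa using hn)
  have hval : ∀ y, F y = fourierCoeff F 0 := by
    intro y
    have := (has_pointwise_sum_fourier_series_of_summable hs y).unique
      (hasSum_single 0 fun n hn => by rw [hcoef n hn, zero_smul])
    simpa using this
  have hIco : ∀ x ∈ Ico a (a + Real.pi), H x = fourierCoeff F 0 := by
    intro x hx
    rw [← hval x]
    exact (AddCircle.liftIco_coe_apply hx).symm
  have ha : H a = fourierCoeff F 0 := hIco a ⟨le_rfl, by linarith [Real.pi_pos]⟩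
  intro x hx
  rcases hx.2.eq_or_lt with h | h
  · rw [h, hper]
  · rw [hIco x ⟨hx.1, h⟩, ha]

/-- Uniqueness from boundary values on an arc of the unit circle. -/
theorem eqOn_zero_of_eqOn_zero_arc {V : Set ℂ} (hV : IsOpen V) (hVc : Convex ℝ V) {K : ℂ → ℂ}
    (hKc : ContinuousOn K (V ∩ closedBall 0 1)) (hKd : DifferentiableOn ℂ K (V ∩ ball 0 1))
    (hK0 : ∀ z ∈ V ∩ sphere 0 1, K z = 0) (hne : (V ∩ sphere (0 : ℂ) 1).Nonempty) :
    ∀ z ∈ V ∩ ball 0 1, K z = 0 := by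
  obtain ⟨c, hcV, hc1⟩ := hne
  rw [mem_sphere_zero_iff_norm] at hc1
  obtain ⟨δ, hδ, hδV⟩ := Metric.isOpen_iff.1 hV c hcV
  set A : Set ℂ := {a | ‖a - c‖ < δ / 2 ∧ 1 - ‖a‖ ^ 2 < (δ / 2) ^ 2 ∧ ‖a‖ < 1} with hA
  have hAo : IsOpen A := by
    refine IsOpen.and ?_ (IsOpen.and ?_ ?_) <;> exact isOpen_lt (by fun_prop) (by fun_prop)
  have hvan : ∀ a ∈ A, K a = 0 := by
    rintro a ⟨ha1, ha2, ha3⟩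
    -- On the boundary of this lens `a + ξ` or `a - ξ` lies on the unit circle, so `K (a + ξ) * K (a
    -- - ξ)` vanishes there. The maximum principle at `ξ = 0` gives `K a ^ 2 = 0`. By the
    -- parallelogram law `‖ξ‖² ≤ 1 - ‖a‖²`, which keeps both points near `c`, hence in `V`.
    set W : Set ℂ := {ξ | ‖a + ξ‖ < 1 ∧ ‖a - ξ‖ < 1} with hW
    have hWo : IsOpen W := by
      refine IsOpen.and ?_ ?_ <;> exact isOpen_lt (by fun_prop) (by fun_prop)
    have hcl : closure W ⊆ {ξ | ‖a + ξ‖ ≤ 1 ∧ ‖a - ξ‖ ≤ 1} :=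
      closure_minimal (fun ξ hξ => ⟨hξ.1.le, hξ.2.le⟩)
        (by refine IsClosed.and ?_ ?_ <;> exact isClosed_le (by fun_prop) (by fun_prop))
    have hsmall : ∀ ξ ∈ closure W, ‖ξ‖ < δ / 2 := by
      intro ξ hξ
      obtain ⟨h1, h2⟩ := hcl hξ
      have hp := parallelogram_law_with_norm ℝ a ξ
      have : ‖ξ‖ ^ 2 < (δ / 2) ^ 2 := by
        nlinarith [norm_nonneg (a + ξ), norm_nonneg (a - ξ)]
      exact lt_of_pow_lt_pow_left₀ 2 (by positivity) this
    have hVp : ∀ ξ ∈ closure W, a + ξ ∈ V := fun ξ hξ => hδV <| by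
      rw [mem_ball, dist_eq_norm]
      calc ‖a + ξ - c‖ = ‖(a - c) + ξ‖ := by ring_nf
        _ ≤ ‖a - c‖ + ‖ξ‖ := norm_add_le _ _
        _ < δ := by linarith [hsmall ξ hξ]
    have hVm : ∀ ξ ∈ closure W, a - ξ ∈ V := fun ξ hξ => hδV <| by
      rw [mem_ball, dist_eq_norm]
      calc ‖a - ξ - c‖ = ‖(a - c) - ξ‖ := by ring_nf
        _ ≤ ‖a - c‖ + ‖ξ‖ := norm_sub_le _ _
        _ < δ := by linarith [hsmall ξ hξ]
    have hdc : DiffContOnCl ℂ (fun ξ => K (a + ξ) * K (a - ξ)) W := by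
      refine ⟨?_, ?_⟩
      · refine (hKd.comp (by fun_prop) ?_).mul (hKd.comp (by fun_prop) ?_)
        · exact fun ξ hξ => ⟨hVp ξ (subset_closure hξ), by simpa using hξ.1⟩
        · exact fun ξ hξ => ⟨hVm ξ (subset_closure hξ), by simpa using hξ.2⟩
      · refine (hKc.comp (by fun_prop) ?_).mul (hKc.comp (by fun_prop) ?_)
        · exact fun ξ hξ => ⟨hVp ξ hξ, by simpa using (hcl hξ).1⟩
        · exact fun ξ hξ => ⟨hVm ξ hξ, by simpa using (hcl hξ).2⟩
    have hb : Bornology.IsBounded W := isBounded_ball.subset fun ξ hξ =>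
      mem_ball_zero_iff.2 (hsmall ξ (subset_closure hξ))
    have := norm_le_of_forall_mem_frontier_norm_le (C := 0) hb hdc (fun ξ hξ => ?_)
      (z := 0) (subset_closure (by simpa [hW] using ha3))
    · have h0 : ‖K a‖ * ‖K a‖ ≤ 0 := by simpa using this
      exact norm_eq_zero.1 (by nlinarith)
    · rw [hWo.frontier_eq] at hξ
      obtain ⟨h1, h2⟩ := hcl hξ.1
      rcases h1.lt_or_eq with h1' | h1'
      · rcases h2.lt_or_eq with h2' | h2'
        · exact absurd ⟨h1', h2'⟩ hξ.2
        · simp [hK0 (a - ξ) ⟨hVm ξ hξ.1, by simpa using h2'⟩]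
      · simp [hK0 (a + ξ) ⟨hVp ξ hξ.1, by simpa using h1'⟩]
  have hAne : ∃ a ∈ A, a ∈ V ∩ ball 0 1 := by
    have ht : Tendsto (fun s : ℝ => (s : ℂ) * c) (𝓝[<] 1) (𝓝 c) := by
      have : Continuous fun s : ℝ => (s : ℂ) * c := by fun_prop
      simpa using this.continuousWithinAt.tendsto (s := Iio 1) (x := 1)
    have e1 : ∀ᶠ a in 𝓝 c, a ∈ ball c (δ / 2) := ball_mem_nhds _ (half_pos hδ)
    have e2 : ∀ᶠ a in 𝓝 c, 1 - ‖a‖ ^ 2 < (δ / 2) ^ 2 := by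
      have : Continuous fun a : ℂ => 1 - ‖a‖ ^ 2 := by fun_prop
      refine this.continuousAt.eventually_lt continuousAt_const ?_
      rw [hc1]; norm_num; positivity
    have e4 : ∀ᶠ s : ℝ in 𝓝[<] 1, s < 1 := self_mem_nhdsWithin
    have e5 : ∀ᶠ s : ℝ in 𝓝[<] 1, 0 < s :=
      mem_nhdsWithin_of_mem_nhds (Ioi_mem_nhds (zero_lt_one' ℝ))
    obtain ⟨s, h1, h2, h3, h4, h5⟩ := ((ht.eventually e1).and ((ht.eventually e2).and
      ((ht.eventually (hV.mem_nhds hcV)).and (e4.and e5)))).exists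
    have hn : ‖(s : ℂ) * c‖ < 1 := by
      rw [norm_mul, hc1, norm_real, Real.norm_eq_abs, mul_one, abs_of_pos h5]; exact h4
    refine ⟨s * c, ⟨?_, h2, hn⟩, h3, by simpa using hn⟩
    rwa [mem_ball, dist_eq_norm] at h1
  obtain ⟨a, haA, haV⟩ := hAne
  have han : AnalyticOnNhd ℂ K (V ∩ ball 0 1) := hKd.analyticOnNhd (hV.inter isOpen_ball)
  exact han.eqOn_zero_of_preconnected_of_eventuallyEq_zero
    (hVc.inter (convex_ball _ _)).isPreconnected haV
    (Filter.eventually_of_mem (hAo.mem_nhds haA) hvan)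

/-! ### The test forms on the two families of curves -/

/-- The form `(w - i)^k / (w + i)^(k+2) dw` pulled back to the curve `w = t / z`. -/
noncomputable def kernelCentered (k : ℕ) (z : ℂ) (t : ℝ) : ℂ :=
  z * (t - I * z) ^ k / (t + I * z) ^ (k + 2)

/-- The form `(w - i)^k / (w + i)^(k+2) dw` pulled back to the curve
`1 / (1 - w) = t - 1 / (1 - z)`. -/
noncomputable def kernelHorocyclic (k : ℕ) (z : ℂ) (t : ℝ) : ℂ :=
  ((1 - I) * (t - (1 - z)⁻¹) - 1) ^ k / ((1 + I) * (t - (1 - z)⁻¹) - 1) ^ (k + 2)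

theorem exp_two_mul_natCast_eq (n : ℕ) (α : ℝ) :
    exp (2 * n * α * I) = exp (α * I) ^ (2 * n) := by
  rw [← exp_nat_mul]; congr 1; push_cast; ring

theorem cos_sub_sin_mul_I_eq_inv (α : ℝ) :
    (Real.cos α - Real.sin α * I : ℂ) = (exp (α * I))⁻¹ := by
  rw [← exp_neg, ← neg_mul, exp_mul_I]
  simp [sub_eq_add_neg]

/-- Here `t = x tan α`, so `w = t / x = tan α`. Then `(w - i) / (w + i) = -e^{2iα}` and `dw / (w +
i)² = -e^{2iα} dα`. -/
theorem kernelCentered_tan {x α : ℝ} (hx : x ≠ 0) (hc : Real.cos α ≠ 0) (k : ℕ) :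
    (x / Real.cos α ^ 2 : ℝ) * kernelCentered k x (x * (Real.sin α / Real.cos α)) =
      (-1) ^ (k + 1) * exp (2 * (k + 1 : ℕ) * α * I) := by
  have e1 := exp_mul_I (α : ℂ)
  rw [← ofReal_cos, ← ofReal_sin] at e1
  have e2 := cos_sub_sin_mul_I_eq_inv α
  have hE := exp_ne_zero (α * I)
  rw [exp_two_mul_natCast_eq]
  set E := exp (α * I)
  have hc' : (Real.cos α : ℂ) ≠ 0 := by exact_mod_cast hc
  have hx' : (x : ℂ) ≠ 0 := by exact_mod_cast hx
  have n1 : ((x * (Real.sin α / Real.cos α) : ℝ) - I * x : ℂ) = x * (-I * E) / Real.cos α := by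
    rw [e1]; push_cast at hc' ⊢; field_simp; ring_nf; simp
  have n2 : ((x * (Real.sin α / Real.cos α) : ℝ) + I * x : ℂ) = x * (I * E⁻¹) / Real.cos α := by
    rw [← e2]; push_cast at hc' ⊢; field_simp; ring_nf; simp
  rw [kernelCentered, n1, n2]
  have hI : (I : ℂ) ≠ 0 := I_ne_zero
  push_cast at hc' ⊢
  rw [div_pow, div_pow, mul_pow, mul_pow, mul_pow, mul_pow, neg_pow, inv_pow]
  field_simp
  have hI2 : I ^ (k + 2) = -I ^ k := by rw [pow_add, I_sq]; ring
  rw [hI2]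
  ring

/-- Again `w = tan α`: the parameter is chosen so that `t - 1 / (1 - x) = cos α / (cos α - sin α) =
1 / (1 - w)`. This form stays regular at `w = ∞`, where `cos α = 0`. -/
theorem kernelHorocyclic_tan {x α : ℝ} (hc : Real.cos α - Real.sin α ≠ 0) (k : ℕ) :
    (1 / (Real.cos α - Real.sin α) ^ 2 : ℝ) *
      kernelHorocyclic k x ((1 - x)⁻¹ + Real.cos α / (Real.cos α - Real.sin α)) =
      (-1) ^ (k + 1) * exp (2 * (k + 1 : ℕ) * α * I) := by
  have e1 := exp_mul_I (α : ℂ)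
  rw [← ofReal_cos, ← ofReal_sin] at e1
  have e2 := cos_sub_sin_mul_I_eq_inv α
  have hE := exp_ne_zero (α * I)
  rw [exp_two_mul_natCast_eq]
  set E := exp (α * I)
  have hc' : (Real.cos α - Real.sin α : ℂ) ≠ 0 := by exact_mod_cast hc
  have n1 : ((1 - I) * (((1 - x)⁻¹ + Real.cos α / (Real.cos α - Real.sin α) : ℝ) - (1 - x : ℂ)⁻¹) - 1)
      = (-I * E) / (Real.cos α - Real.sin α) := by
    rw [e1]; push_cast at hc' ⊢; rw [add_sub_cancel_left]; field_simp; ring_nf; simp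
  have n2 : ((1 + I) * (((1 - x)⁻¹ + Real.cos α / (Real.cos α - Real.sin α) : ℝ) - (1 - x : ℂ)⁻¹) - 1)
      = (I * E⁻¹) / (Real.cos α - Real.sin α) := by
    rw [← e2]; push_cast at hc' ⊢; rw [add_sub_cancel_left]; field_simp; ring_nf; simp
  rw [kernelHorocyclic, n1, n2]
  have hI : (I : ℂ) ≠ 0 := I_ne_zero
  push_cast at hc' ⊢
  rw [div_pow, div_pow, mul_pow, mul_pow, neg_pow, inv_pow]
  field_simp
  have hI2 : I ^ (k + 2) = -I ^ k := by rw [pow_add, I_sq]; ring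
  rw [hI2]
  ring

theorem continuousOn_kernelCentered (k : ℕ) :
    ContinuousOn (Function.uncurry (kernelCentered k)) ({z | 0 < z.re ∧ z.im ≤ 0} ×ˢ Ioi 0) := by
  refine ContinuousOn.div (by fun_prop) (by fun_prop) ?_
  rintro ⟨z, t⟩ ⟨⟨hz, -⟩, -⟩
  refine pow_ne_zero _ fun h => ?_
  have := congrArg im h
  simp at this
  simp only at hz
  linarith

theorem differentiableAt_kernelCentered (k : ℕ) {z : ℂ} (hz : 0 < z.re) (t : ℝ) :
    DifferentiableAt ℂ (fun z => kernelCentered k z t) z := by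
  refine DifferentiableAt.div (by fun_prop) (by fun_prop) ?_
  refine pow_ne_zero _ fun h => ?_
  have := congrArg im h
  simp at this
  linarith

/-- Vanishing would mean `w = -i`, where `1 / (1 - w)` has imaginary part `-1/2`; but `t - 1 / (1 -
z)` has nonnegative imaginary part when `Im z ≤ 0`. -/
theorem kernelHorocyclic_denom_ne_zero {z : ℂ} (hz : z.im ≤ 0) (t : ℝ) :
    (1 + I) * (t - (1 - z)⁻¹) - 1 ≠ 0 := by
  intro h
  have h1 := congrArg im h
  have h2 := congrArg re h
  simp [inv_re, inv_im] at h1 h2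
  have : z.im / normSq (1 - z) ≤ 0 := div_nonpos_of_nonpos_of_nonneg hz (normSq_nonneg _)
  linarith

theorem continuousOn_kernelHorocyclic (k : ℕ) :
    ContinuousOn (Function.uncurry (kernelHorocyclic k)) ({z | z.re < 1 ∧ z.im ≤ 0} ×ˢ univ) := by
  have hinv : ContinuousOn (fun q : ℂ × ℝ => (1 - q.1)⁻¹) ({z | z.re < 1 ∧ z.im ≤ 0} ×ˢ univ) := by
    refine ContinuousOn.inv₀ (by fun_prop) ?_
    rintro ⟨z, t⟩ ⟨⟨hz, -⟩, -⟩ h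
    have := congrArg re h
    simp at this
    simp only at hz
    linarith
  refine ContinuousOn.div (by fun_prop) (by fun_prop) ?_
  rintro ⟨z, t⟩ ⟨⟨-, hz⟩, -⟩
  exact pow_ne_zero _ (kernelHorocyclic_denom_ne_zero hz t)

theorem differentiableAt_kernelHorocyclic (k : ℕ) {z : ℂ} (hz1 : z.re < 1) (hz : z.im ≤ 0) (t : ℝ) :
    DifferentiableAt ℂ (fun z => kernelHorocyclic k z t) z := by
  have hinv : DifferentiableAt ℂ (fun z : ℂ => (1 - z)⁻¹) z := by
    refine DifferentiableAt.inv (by fun_prop) fun h => ?_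
    have := congrArg re h
    simp at this
    linarith
  exact DifferentiableAt.div (by fun_prop) (by fun_prop)
    (pow_ne_zero _ (kernelHorocyclic_denom_ne_zero hz t))

/-! ### The loop around the real projective line: `w = tan α` from `x` to `1 / x`, then through
infinity back to `x` -/

section Loop

variable {x α : ℝ}

theorem sin_arctan_eq_mul_cos (x : ℝ) :
    Real.sin (Real.arctan x) = x * Real.cos (Real.arctan x) := by
  rw [← Real.tan_mul_cos (Real.cos_arctan_pos x).ne', Real.tan_arctan]

theorem mul_cos_le_sin (hα : α ∈ Icc (Real.arctan x) (Real.arctan x + Real.pi)) :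
    x * Real.cos α ≤ Real.sin α := by
  have h := Real.sin_nonneg_of_nonneg_of_le_pi (sub_nonneg.2 hα.1) (by linarith [hα.2])
  have hc := Real.cos_arctan_pos x
  rw [Real.sin_sub, sin_arctan_eq_mul_cos] at h
  nlinarith

theorem mul_sin_le_cos (hx : 0 < x)
    (hα : α ∈ Icc (Real.arctan x) (Real.pi / 2 - Real.arctan x)) :
    x * Real.sin α ≤ Real.cos α := by
  have := Real.arctan_pos.2 hx
  have h := Real.cos_nonneg_of_mem_Icc (x := α + Real.arctan x)
    ⟨by linarith [hα.1, Real.pi_pos], by linarith [hα.2]⟩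
  have hc := Real.cos_arctan_pos x
  rw [Real.cos_add, sin_arctan_eq_mul_cos] at h
  nlinarith

theorem arctan_lt_pi_div_four (hx : x < 1) : Real.arctan x < Real.pi / 4 := by
  rw [← Real.arctan_one]
  exact Real.arctan_strictMono hx

theorem cos_le_mul_sin (hx1 : x < 1)
    (hα : α ∈ Icc (Real.pi / 2 - Real.arctan x) (Real.arctan x + Real.pi)) :
    Real.cos α ≤ x * Real.sin α := by
  have h := Real.cos_nonpos_of_pi_div_two_le_of_le (x := α + Real.arctan x)
    (by linarith [hα.1]) (by linarith [hα.2, arctan_lt_pi_div_four hx1])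
  have hc := Real.cos_arctan_pos x
  rw [Real.cos_add, sin_arctan_eq_mul_cos] at h
  nlinarith

theorem cos_pos_of_mem_first_arc (hx : 0 < x)
    (hα : α ∈ Icc (Real.arctan x) (Real.pi / 2 - Real.arctan x)) : 0 < Real.cos α := by
  have := Real.arctan_pos.2 hx
  exact Real.cos_pos_of_mem_Ioo ⟨by linarith [hα.1, Real.pi_pos], by linarith [hα.2]⟩

theorem cos_sub_sin_neg_of_mem_second_arc (hx : 0 < x) (hx1 : x < 1)
    (hα : α ∈ Icc (Real.pi / 2 - Real.arctan x) (Real.arctan x + Real.pi)) :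
    Real.cos α - Real.sin α < 0 := by
  have h1 := cos_le_mul_sin hx1 hα
  have h4 := arctan_lt_pi_div_four hx1
  have h2 := mul_cos_le_sin (x := x) ⟨by linarith [hα.1], hα.2⟩
  rcases lt_or_ge 0 (Real.sin α) with hs | hs
  · nlinarith
  · have hc : Real.cos α < 0 := by
      rcases (show Real.cos α ≤ 0 by nlinarith).lt_or_eq with h | h
      · exact h
      · rw [h] at h1 h2
        have : Real.sin α = 0 := by nlinarith
        have h3 := Real.sin_sq_add_cos_sq α
        rw [h, this] at h3
        norm_num at h3
    nlinarith

theorem tan_first_arc_mem (hx : 0 < x)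
    (hα : α ∈ Icc (Real.arctan x) (Real.pi / 2 - Real.arctan x)) :
    x * (Real.sin α / Real.cos α) ∈ Icc (x ^ 2) 1 := by
  have hc := cos_pos_of_mem_first_arc hx hα
  have h1 := mul_cos_le_sin (x := x) ⟨hα.1, by linarith [hα.2, Real.arctan_pos.2 hx, Real.pi_pos]⟩
  have h2 := mul_sin_le_cos hx hα
  rw [← mul_div_assoc]
  constructor
  · rw [le_div_iff₀ hc]; nlinarith
  · rw [div_le_one hc]; exact h2

theorem tan_second_arc_mem (hx : 0 < x) (hx1 : x < 1)
    (hα : α ∈ Icc (Real.pi / 2 - Real.arctan x) (Real.arctan x + Real.pi)) :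
    (1 - x)⁻¹ + Real.cos α / (Real.cos α - Real.sin α) ∈ Icc 1 (2 / (1 - x)) := by
  have hc := cos_sub_sin_neg_of_mem_second_arc hx hx1 hα
  have h1 := cos_le_mul_sin hx1 hα
  have h2 := mul_cos_le_sin (x := x) ⟨by linarith [hα.1, arctan_lt_pi_div_four hx1], hα.2⟩
  have hx' : 0 < 1 - x := by linarith
  have e : (1 - x)⁻¹ + Real.cos α / (Real.cos α - Real.sin α) =
      ((2 - x) * -Real.cos α + Real.sin α) / ((1 - x) * (Real.sin α - Real.cos α)) := by
    have h3 : Real.sin α - Real.cos α ≠ 0 := by linarith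
    have h4 : Real.cos α - Real.sin α ≠ 0 := hc.ne
    field_simp
    ring
  have hd : 0 < (1 - x) * (Real.sin α - Real.cos α) := mul_pos hx' (by linarith)
  rw [e]
  constructor
  · rw [le_div_iff₀ hd]; nlinarith
  · rw [div_le_div_iff₀ hd hx']; nlinarith [mul_nonneg hx'.le (sub_nonneg.2 h2)]

theorem tan_first_arc_left (x : ℝ) :
    x * (Real.sin (Real.arctan x) / Real.cos (Real.arctan x)) = x ^ 2 := by
  rw [← Real.tan_eq_sin_div_cos, Real.tan_arctan, sq]

theorem tan_first_arc_right (hx : 0 < x) :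
    x * (Real.sin (Real.pi / 2 - Real.arctan x) / Real.cos (Real.pi / 2 - Real.arctan x)) = 1 := by
  have hc := Real.cos_arctan_pos x
  rw [Real.sin_pi_div_two_sub, Real.cos_pi_div_two_sub, sin_arctan_eq_mul_cos]
  field_simp

theorem tan_second_arc_left (hx1 : x < 1) :
    (1 - x)⁻¹ + Real.cos (Real.pi / 2 - Real.arctan x) /
      (Real.cos (Real.pi / 2 - Real.arctan x) - Real.sin (Real.pi / 2 - Real.arctan x)) = 1 := by
  have hc := (Real.cos_arctan_pos x).ne'
  have hx' : 1 - x ≠ 0 := by linarith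
  have hx'' : x - 1 ≠ 0 := by linarith
  rw [Real.sin_pi_div_two_sub, Real.cos_pi_div_two_sub, sin_arctan_eq_mul_cos, ← sub_one_mul]
  field_simp
  ring

theorem tan_second_arc_right (hx1 : x < 1) :
    (1 - x)⁻¹ + Real.cos (Real.arctan x + Real.pi) /
      (Real.cos (Real.arctan x + Real.pi) - Real.sin (Real.arctan x + Real.pi)) = 2 / (1 - x) := by
  have hc := (Real.cos_arctan_pos x).ne'
  have hx' : 1 - x ≠ 0 := by linarith
  rw [Real.sin_add_pi, Real.cos_add_pi, sin_arctan_eq_mul_cos,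
    show -Real.cos (Real.arctan x) - -(x * Real.cos (Real.arctan x)) =
      -((1 - x) * Real.cos (Real.arctan x)) by ring, neg_div_neg_eq]
  field_simp
  norm_num

theorem integral_first_arc (hx : 0 < x) (hx1 : x < 1) {a : ℝ → ℂ} (ha : ContinuousOn a (Icc (x ^ 2) 1))
    (k : ℕ) :
    ∫ α in (Real.arctan x)..(Real.pi / 2 - Real.arctan x),
      a (x * (Real.sin α / Real.cos α)) * exp (2 * (k + 1 : ℕ) * α * I) =
    (-1) ^ (k + 1) * ∫ t in (x ^ 2)..1, a t * kernelCentered k x t := by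
  have hle : Real.arctan x ≤ Real.pi / 2 - Real.arctan x := by linarith [arctan_lt_pi_div_four hx1]
  have hcos : ∀ α ∈ uIcc (Real.arctan x) (Real.pi / 2 - Real.arctan x), Real.cos α ≠ 0 :=
    fun α hα => (cos_pos_of_mem_first_arc hx (uIcc_of_le hle ▸ hα)).ne'
  have hder : ∀ α, Real.cos α ≠ 0 →
      HasDerivAt (fun α => x * (Real.sin α / Real.cos α)) (x / Real.cos α ^ 2) α := by
    intro α hα
    refine (((Real.hasDerivAt_sin α).div (Real.hasDerivAt_cos α) hα).const_mul x).congr_deriv ?_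
    rw [show Real.cos α * Real.cos α - Real.sin α * -Real.sin α = 1 by
      nlinarith [Real.sin_sq_add_cos_sq α]]
    ring
  have key := intervalIntegral.integral_deriv_smul_comp''
    (f := fun α => x * (Real.sin α / Real.cos α)) (f' := fun α => x / Real.cos α ^ 2)
    (g := fun t => a t * kernelCentered k x t) (a := Real.arctan x)
    (b := Real.pi / 2 - Real.arctan x)
    (fun α hα => (hder α (hcos α hα)).continuousAt.continuousWithinAt)
    (fun α hα => (hder α (hcos α (Ioo_subset_Icc_self hα))).hasDerivWithinAt)
    (ContinuousOn.div (by fun_prop) (by fun_prop) fun α hα => pow_ne_zero _ (hcos α hα)) ?_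
  · simp only [tan_first_arc_left, tan_first_arc_right hx] at key
    rw [← key, ← intervalIntegral.integral_const_mul]
    refine intervalIntegral.integral_congr fun α hα => ?_
    have := kernelCentered_tan hx.ne' (hcos α hα) k
    simp only [Function.comp, real_smul]
    rw [mul_left_comm _ (a _), this, mul_left_comm, ← mul_assoc ((-1) ^ (k + 1)), ← mul_pow]
    simp
  · have hsub : (fun α => x * (Real.sin α / Real.cos α)) ''
        uIcc (Real.arctan x) (Real.pi / 2 - Real.arctan x) ⊆ Icc (x ^ 2) 1 := by
      rintro _ ⟨α, hα, rfl⟩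
      exact tan_first_arc_mem hx (uIcc_of_le hle ▸ hα)
    refine (ha.mono hsub).mul ?_
    refine (continuousOn_kernelCentered k).comp (f := fun t : ℝ => ((x : ℂ), t)) (by fun_prop) ?_
    intro t ht
    exact ⟨⟨by simpa using hx, by simp⟩, lt_of_lt_of_le (by positivity) (hsub ht).1⟩

theorem integral_second_arc (hx : 0 < x) (hx1 : x < 1) {a : ℝ → ℂ}
    (ha : ContinuousOn a (Icc 1 (2 / (1 - x)))) (k : ℕ) :
    ∫ α in (Real.pi / 2 - Real.arctan x)..(Real.arctan x + Real.pi),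
      a ((1 - x)⁻¹ + Real.cos α / (Real.cos α - Real.sin α)) * exp (2 * (k + 1 : ℕ) * α * I) =
    (-1) ^ (k + 1) * ∫ t in (1 : ℝ)..(2 / (1 - x)), a t * kernelHorocyclic k x t := by
  have hle : Real.pi / 2 - Real.arctan x ≤ Real.arctan x + Real.pi := by
    linarith [Real.arctan_pos.2 hx, Real.pi_pos]
  have hcos : ∀ α ∈ uIcc (Real.pi / 2 - Real.arctan x) (Real.arctan x + Real.pi),
      Real.cos α - Real.sin α ≠ 0 :=
    fun α hα => (cos_sub_sin_neg_of_mem_second_arc hx hx1 (uIcc_of_le hle ▸ hα)).ne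
  have hder : ∀ α, Real.cos α - Real.sin α ≠ 0 →
      HasDerivAt (fun α => (1 - x)⁻¹ + Real.cos α / (Real.cos α - Real.sin α))
        (1 / (Real.cos α - Real.sin α) ^ 2) α := by
    intro α hα
    refine (((Real.hasDerivAt_cos α).div ((Real.hasDerivAt_cos α).sub (Real.hasDerivAt_sin α))
      hα).const_add _).congr_deriv ?_
    congr 1
    simp only [Pi.sub_apply]
    nlinarith [Real.sin_sq_add_cos_sq α]
  have key := intervalIntegral.integral_deriv_smul_comp''
    (f := fun α => (1 - x)⁻¹ + Real.cos α / (Real.cos α - Real.sin α))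
    (f' := fun α => 1 / (Real.cos α - Real.sin α) ^ 2)
    (g := fun t => a t * kernelHorocyclic k x t) (a := Real.pi / 2 - Real.arctan x)
    (b := Real.arctan x + Real.pi)
    (fun α hα => (hder α (hcos α hα)).continuousAt.continuousWithinAt)
    (fun α hα => (hder α (hcos α (Ioo_subset_Icc_self hα))).hasDerivWithinAt)
    (ContinuousOn.div (by fun_prop) (by fun_prop) fun α hα => pow_ne_zero _ (hcos α hα)) ?_
  · simp only [tan_second_arc_left hx1, tan_second_arc_right hx1] at key
    rw [← key, ← intervalIntegral.integral_const_mul]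
    refine intervalIntegral.integral_congr fun α hα => ?_
    have := kernelHorocyclic_tan (x := x) (hcos α hα) k
    simp only [Function.comp, real_smul]
    rw [mul_left_comm _ (a _), this, mul_left_comm, ← mul_assoc ((-1) ^ (k + 1)), ← mul_pow]
    simp
  · have hsub : (fun α => (1 - x)⁻¹ + Real.cos α / (Real.cos α - Real.sin α)) ''
        uIcc (Real.pi / 2 - Real.arctan x) (Real.arctan x + Real.pi) ⊆ Icc 1 (2 / (1 - x)) := by
      rintro _ ⟨α, hα, rfl⟩
      exact tan_second_arc_mem hx hx1 (uIcc_of_le hle ▸ hα)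
    refine (ha.mono hsub).mul ?_
    refine (continuousOn_kernelHorocyclic k).comp (f := fun t : ℝ => ((x : ℂ), t)) (by fun_prop) ?_
    intro t ht
    exact ⟨⟨by simpa using hx1, by simp⟩, mem_univ _⟩

/-- A continuous function on the real projective line, given on two complementary arcs, all whose
moments against the forms `(w ∓ i)^k / (w ± i)^(k+2) dw` vanish, is constant. -/
theorem eq_const_of_moments_eq_zero (hx : 0 < x) (hx1 : x < 1) {a₁ a₂ : ℝ → ℂ}
    (ha₁ : ContinuousOn a₁ (Icc (x ^ 2) 1)) (ha₂ : ContinuousOn a₂ (Icc 1 (2 / (1 - x))))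
    (h1 : a₁ 1 = a₂ 1) (h2 : a₁ (x ^ 2) = a₂ (2 / (1 - x)))
    (hm : ∀ k : ℕ, ∫ t in (x ^ 2)..1, a₁ t * kernelCentered k x t =
      ∫ t in (2 / (1 - x))..1, a₂ t * kernelHorocyclic k x t)
    (hm' : ∀ k : ℕ, ∫ t in (x ^ 2)..1, (starRingEnd ℂ) (a₁ t) * kernelCentered k x t =
      ∫ t in (2 / (1 - x))..1, (starRingEnd ℂ) (a₂ t) * kernelHorocyclic k x t) :
    (∀ t ∈ Icc (x ^ 2) 1, a₁ t = a₁ 1) ∧ ∀ t ∈ Icc 1 (2 / (1 - x)), a₂ t = a₁ 1 := by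
  set A₀ := Real.arctan x with hA₀
  set A₁ := Real.pi / 2 - A₀ with hA₁
  set A₂ := A₀ + Real.pi with hA₂
  have hA0 : 0 < A₀ := Real.arctan_pos.2 hx
  have hA4 : A₀ < Real.pi / 4 := arctan_lt_pi_div_four hx1
  have h01 : A₀ ≤ A₁ := by linarith
  have h12 : A₁ ≤ A₂ := by linarith
  set φ₁ : ℝ → ℝ := fun α => x * (Real.sin α / Real.cos α) with hφ₁
  set φ₂ : ℝ → ℝ := fun α => (1 - x)⁻¹ + Real.cos α / (Real.cos α - Real.sin α) with hφ₂
  have hφ₁c : ContinuousOn φ₁ (Icc A₀ A₁) := ContinuousOn.mul (by fun_prop)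
    (ContinuousOn.div (by fun_prop) (by fun_prop)
      fun α hα => (cos_pos_of_mem_first_arc hx hα).ne')
  have hφ₂c : ContinuousOn φ₂ (Icc A₁ A₂) := ContinuousOn.add (by fun_prop)
    (ContinuousOn.div (by fun_prop) (by fun_prop)
      fun α hα => (cos_sub_sin_neg_of_mem_second_arc hx hx1 hα).ne)
  have hb₁ : ContinuousOn (fun α => a₁ (φ₁ α)) (Icc A₀ A₁) :=
    ha₁.comp hφ₁c fun α hα => tan_first_arc_mem hx hα
  have hb₂ : ContinuousOn (fun α => a₂ (φ₂ α)) (Icc A₁ A₂) :=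
    ha₂.comp hφ₂c fun α hα => tan_second_arc_mem hx hx1 hα
  have e10 : φ₁ A₀ = x ^ 2 := tan_first_arc_left x
  have e11 : φ₁ A₁ = 1 := tan_first_arc_right hx
  have e21 : φ₂ A₁ = 1 := tan_second_arc_left hx1
  have e22 : φ₂ A₂ = 2 / (1 - x) := tan_second_arc_right hx1
  set H : ℝ → ℂ := fun α => if α ≤ A₁ then a₁ (φ₁ α) else a₂ (φ₂ α) with hH
  have hH₁ : EqOn H (fun α => a₁ (φ₁ α)) (Icc A₀ A₁) := fun α hα => if_pos hα.2
  have hH₂ : EqOn H (fun α => a₂ (φ₂ α)) (Icc A₁ A₂) := by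
    intro α hα
    rcases hα.1.eq_or_lt with h | h
    · simp only [hH, ← h, le_refl, if_true, e11, e21, h1]
    · exact if_neg h.not_ge
  have hHc : ContinuousOn H (Icc A₀ A₂) := by
    rw [← Icc_union_Icc_eq_Icc h01 h12]
    exact (hb₁.congr hH₁).union_of_isClosed (hb₂.congr hH₂) isClosed_Icc isClosed_Icc
  have hper : H A₀ = H A₂ := by
    rw [hH₁ ⟨le_rfl, h01⟩, hH₂ ⟨h12, le_rfl⟩]
    simp only [e10, e22, h2]
  have ii : ∀ c d, A₀ ≤ c → c ≤ d → d ≤ A₂ → ∀ E : ℝ → ℂ, ContinuousOn E (Icc A₀ A₂) →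
      IntervalIntegrable E volume c d := fun c d h1 h2 h3 E hE =>
    ContinuousOn.intervalIntegrable (hE.mono (uIcc_of_le h2 ▸ Icc_subset_Icc h1 h3))
  have mom : ∀ c : ℂ → ℂ, Continuous c → (∀ k : ℕ,
      ∫ t in (x ^ 2)..1, c (a₁ t) * kernelCentered k x t =
        ∫ t in (2 / (1 - x))..1, c (a₂ t) * kernelHorocyclic k x t) →
      ∀ k : ℕ, ∫ α in A₀..A₂, c (H α) * exp (2 * (k + 1 : ℕ) * α * I) = 0 := by
    intro c hc hck k
    have hE : ContinuousOn (fun α : ℝ => c (H α) * exp (2 * (k + 1 : ℕ) * α * I)) (Icc A₀ A₂) :=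
      (hc.comp_continuousOn hHc).mul (by fun_prop)
    have s1 : ∫ α in A₀..A₁, c (H α) * exp (2 * (k + 1 : ℕ) * α * I) = _ :=
      (intervalIntegral.integral_congr fun α hα => by
        simp only [hH₁ (uIcc_of_le h01 ▸ hα), hφ₁, Function.comp]).trans
      (integral_first_arc hx hx1 (hc.comp_continuousOn ha₁) k)
    have s2 : ∫ α in A₁..A₂, c (H α) * exp (2 * (k + 1 : ℕ) * α * I) = _ :=
      (intervalIntegral.integral_congr fun α hα => by
        simp only [hH₂ (uIcc_of_le h12 ▸ hα), hφ₂, Function.comp]).trans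
      (integral_second_arc hx hx1 (hc.comp_continuousOn ha₂) k)
    rw [← intervalIntegral.integral_add_adjacent_intervals (ii _ _ le_rfl h01 h12 _ hE)
      (ii _ _ h01 h12 le_rfl _ hE), s1, s2]
    simp only [Function.comp]
    rw [hck k, intervalIntegral.integral_symm 1]
    ring
  have hconst := eq_of_integral_mul_exp_eq_zero hHc hper (by
    intro n hn
    rcases hn.lt_or_gt with hn | hn
    · obtain ⟨k, rfl⟩ : ∃ k : ℕ, n = -((k + 1 : ℕ) : ℤ) := ⟨(-n - 1).toNat, by omega⟩
      -- Conjugating a moment of `conj H` gives a moment of `H` with the opposite frequency.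
      have h := congrArg (starRingEnd ℂ) (mom _ continuous_conj hm' k)
      rw [intervalIntegral.integral_of_le (h01.trans h12), ← integral_conj,
        ← intervalIntegral.integral_of_le (h01.trans h12), map_zero] at h
      refine Eq.trans (intervalIntegral.integral_congr fun α _ => ?_) h
      simp only [map_mul, conj_conj, ← exp_conj, conj_I, conj_ofReal, map_ofNat, map_natCast]
      congr 2
      push_cast
      ring
    · obtain ⟨k, rfl⟩ : ∃ k : ℕ, n = ((k + 1 : ℕ) : ℤ) := ⟨(n - 1).toNat, by omega⟩
      simpa using mom id continuous_id hm k)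
  have hA1 : a₁ 1 = H A₀ := by
    rw [← hconst A₁ ⟨h01, h12⟩, hH₁ ⟨h01, le_rfl⟩]
    simp only [e11]
  constructor
  · intro t ht
    obtain ⟨α, hα, rfl⟩ := intermediate_value_Icc h01 hφ₁c (by rwa [e10, e11])
    rw [hA1, ← hconst α ⟨hα.1, hα.2.trans h12⟩, hH₁ hα]
  · intro t ht
    obtain ⟨α, hα, rfl⟩ := intermediate_value_Icc h12 hφ₂c (by rwa [e21, e22])
    rw [hA1, ← hconst α ⟨h01.trans hα.1, hα.2⟩, hH₂ hα]

end Loop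

/-! ### Morera's theorem for a difference -/

theorem wedgeIntegral_sub_of_continuousOn {A B : ℂ → ℂ} {z w : ℂ}
    (hA : ContinuousOn A (Rectangle z w)) (hB : ContinuousOn B (Rectangle z w)) :
    wedgeIntegral z w (fun z => A z - B z) = wedgeIntegral z w A - wedgeIntegral z w B := by
  have h1 : ∀ F : ℂ → ℂ, ContinuousOn F (Rectangle z w) →
      IntervalIntegrable (fun x : ℝ => F (x + z.im * I)) volume z.re w.re := fun F hF =>
    (hF.comp (by fun_prop) fun x hx => by
      simpa [Rectangle, mem_reProdIm] using hx).intervalIntegrable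
  have h2 : ∀ F : ℂ → ℂ, ContinuousOn F (Rectangle z w) →
      IntervalIntegrable (fun y : ℝ => F (w.re + y * I)) volume z.im w.im := fun F hF =>
    (hF.comp (by fun_prop) fun y hy => by
      simpa [Rectangle, mem_reProdIm] using hy).intervalIntegrable
  simp only [wedgeIntegral]
  rw [intervalIntegral.integral_sub (h1 A hA) (h1 B hB),
    intervalIntegral.integral_sub (h2 A hA) (h2 B hB), smul_sub]
  ring

/-- Neither function need be holomorphic: equal boundary integrals suffice for Morera's theorem on
the difference. -/
theorem differentiableOn_sub_of_wedgeIntegral_eq {S : Set ℂ} (hS : IsOpen S) {A B : ℂ → ℂ}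
    (hA : ContinuousOn A S) (hB : ContinuousOn B S)
    (h : ∀ z w, Rectangle z w ⊆ S →
      wedgeIntegral z w A + wedgeIntegral w z A = wedgeIntegral z w B + wedgeIntegral w z B) :
    DifferentiableOn ℂ (fun z => A z - B z) S := by
  rw [← isConservativeOn_and_continuousOn_iff_isDifferentiableOn hS]
  refine ⟨fun z w hR => ?_, hA.sub hB⟩
  have hR' : Rectangle w z ⊆ S := by
    rwa [Rectangle, uIcc_comm w.re, uIcc_comm w.im]
  rw [wedgeIntegral_sub_of_continuousOn (hA.mono hR) (hB.mono hR),
    wedgeIntegral_sub_of_continuousOn (hA.mono hR') (hB.mono hR')]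
  linear_combination h z w hR

/-! ### Geometry of the circles tangent at `1` -/

/-- Twice the real part of `1 / (1 - z)`: the inverse radius of the circle through `z` that is
internally tangent to the unit circle at `1`. -/
noncomputable def horocyclicLevel (z : ℂ) : ℝ := 2 * ((1 - z)⁻¹).re

theorem horocyclicLevel_eq (z : ℂ) : horocyclicLevel z = 2 * (1 - z.re) / normSq (1 - z) := by
  simp [horocyclicLevel, inv_re]; ring

theorem one_sub_ne_zero_of_re_lt_one {z : ℂ} (hz : z.re < 1) : 1 - z ≠ 0 := fun h => by
  have := congrArg re h
  simp at this
  linarith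

theorem hasFDerivAt_horocyclicLevel {z : ℂ} (hz : z.re < 1) :
    HasFDerivAt horocyclicLevel ((2 : ℝ) • (reCLM.comp
      ((ContinuousLinearMap.toSpanSingleton ℂ ((1 - z)⁻¹ ^ 2)).restrictScalars ℝ))) z := by
  have h1 : HasDerivAt (fun z : ℂ => (1 - z)⁻¹) ((1 - z)⁻¹ ^ 2) z := by
    refine (((hasDerivAt_id z).const_sub 1).inv (one_sub_ne_zero_of_re_lt_one hz)).congr_deriv ?_
    simp
  exact (reCLM.hasFDerivAt.comp z (h1.hasFDerivAt.restrictScalars ℝ)).const_mul 2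

theorem hasFDerivAt_normSq (z : ℂ) :
    HasFDerivAt (fun z : ℂ => normSq z) ((2 * z.re) • reCLM + (2 * z.im) • imCLM) z := by
  have h := (reCLM.hasFDerivAt (x := z)).mul (reCLM.hasFDerivAt (x := z))
  have h' := (imCLM.hasFDerivAt (x := z)).mul (imCLM.hasFDerivAt (x := z))
  refine ((h.add h').congr_fderiv ?_).congr_of_eventuallyEq (Eventually.of_forall fun w => ?_)
  · ext; simp; ring
  · simp [normSq_apply]

theorem normSq_one_add_mul_sub_one (z : ℂ) (t : ℝ) :
    normSq (1 + t * (z - 1)) = 1 - 2 * t * (1 - z.re) + t ^ 2 * normSq (1 - z) := by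
  simp [normSq_apply]; ring

theorem one_lt_horocyclicLevel_iff {z : ℂ} (hz : z.re < 1) : 1 < horocyclicLevel z ↔ normSq z < 1 := by
  have h0 := normSq_pos.2 (one_sub_ne_zero_of_re_lt_one hz)
  rw [horocyclicLevel_eq, lt_div_iff₀ h0]
  simp [normSq_apply]
  constructor <;> intro h <;> nlinarith

theorem horocyclicLevel_eq_one_iff {z : ℂ} (hz : z.re < 1) : horocyclicLevel z = 1 ↔ normSq z = 1 := by
  have h0 := normSq_pos.2 (one_sub_ne_zero_of_re_lt_one hz)
  rw [horocyclicLevel_eq, div_eq_one_iff_eq h0.ne']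
  simp [normSq_apply]
  constructor <;> intro h <;> nlinarith

theorem norm_one_add_mul_sub_one_le_one {z : ℂ} (hz : z.re < 1) {t : ℝ} (ht0 : 0 ≤ t)
    (ht : t ≤ horocyclicLevel z) : ‖1 + t * (z - 1)‖ ≤ 1 := by
  have h0 := normSq_pos.2 (one_sub_ne_zero_of_re_lt_one hz)
  rw [horocyclicLevel_eq, le_div_iff₀ h0] at ht
  rw [← sq_le_one_iff₀ (norm_nonneg _), ← normSq_eq_norm_sq, normSq_one_add_mul_sub_one]
  nlinarith

theorem norm_one_add_horocyclicLevel_mul_sub_one {z : ℂ} (hz : z.re < 1) :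
    ‖1 + horocyclicLevel z * (z - 1)‖ = 1 := by
  have h0 := normSq_pos.2 (one_sub_ne_zero_of_re_lt_one hz)
  have h : horocyclicLevel z * normSq (1 - z) = 2 * (1 - z.re) := by
    rw [horocyclicLevel_eq, div_mul_cancel₀ _ h0.ne']
  rw [← sq_eq_sq₀ (norm_nonneg _) zero_le_one, ← normSq_eq_norm_sq, normSq_one_add_mul_sub_one]
  linear_combination horocyclicLevel z * h

/-! ### The lifted families and their moments -/

/-- Continuous families of holomorphic extensions of `f`, in normalised coordinates, through the
circles `|z|² = t` and through the circles of radius `1 / t` internally tangent at `1`. -/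
structure IsExtensionPair (f : ℂ → ℂ) (r ρ : ℝ) (G₁ G₂ : ℝ → ℂ → ℂ) : Prop where
  cont₁ : Continuous (Function.uncurry G₁)
  cont₂ : Continuous (Function.uncurry G₂)
  hol₁ : ∀ t ∈ Icc (r ^ 2) 1, DifferentiableOn ℂ (G₁ t) (ball 0 1)
  hol₂ : ∀ t ∈ Icc 1 ρ⁻¹, DifferentiableOn ℂ (G₂ t) (ball 0 1)
  bdry₁ : ∀ t ∈ Icc (r ^ 2) 1, ∀ ζ ∈ sphere (0 : ℂ) 1, G₁ t ζ = f (Real.sqrt t * ζ)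
  bdry₂ : ∀ t ∈ Icc 1 ρ⁻¹, ∀ ζ ∈ sphere (0 : ℂ) 1, G₂ t ζ = f (1 + (ζ - 1) / t)

/-- Both families of circles are symmetric in the real axis. This reflection supplies the moments of
the conjugated values, that is, the Fourier coefficients of the opposite sign. -/
theorem IsExtensionPair.conj {f : ℂ → ℂ} {r ρ : ℝ} {G₁ G₂ : ℝ → ℂ → ℂ}
    (h : IsExtensionPair f r ρ G₁ G₂) :
    IsExtensionPair (fun z => (starRingEnd ℂ) (f ((starRingEnd ℂ) z))) r ρ
      (fun t ζ => (starRingEnd ℂ) (G₁ t ((starRingEnd ℂ) ζ)))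
      (fun t ζ => (starRingEnd ℂ) (G₂ t ((starRingEnd ℂ) ζ))) := by
  have hd : ∀ G : ℂ → ℂ, DifferentiableOn ℂ G (ball 0 1) →
      DifferentiableOn ℂ (fun ζ => (starRingEnd ℂ) (G ((starRingEnd ℂ) ζ))) (ball 0 1) := by
    intro G hG ζ hζ
    have hζ' : (starRingEnd ℂ) ζ ∈ ball (0 : ℂ) 1 := by simpa using hζ
    have := (hG.differentiableAt (isOpen_ball.mem_nhds hζ')).conj_conj
    rw [conj_conj] at this
    exact this.differentiableWithinAt
  have hcc : Continuous fun p : ℝ × ℂ => (p.1, (starRingEnd ℂ) p.2) :=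
    continuous_fst.prodMk (continuous_conj.comp continuous_snd)
  refine ⟨continuous_conj.comp (h.cont₁.comp hcc), continuous_conj.comp (h.cont₂.comp hcc),
    fun t ht => hd _ (h.hol₁ t ht), fun t ht => hd _ (h.hol₂ t ht), fun t ht ζ hζ => ?_,
    fun t ht ζ hζ => ?_⟩
  · rw [h.bdry₁ t ht _ (by simpa using hζ)]
    simp
  · rw [h.bdry₂ t ht _ (by simpa using hζ)]
    simp

/-- Both paths start at `w = conj z`, so in either family `dw/dt` times `∂̄` of the level function
is `∂̄ (conj z) = 1`. For `conj z ≠ -i` both sides are therefore `(w - i)^k / (w + i)^(k+2)` at `w =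
conj z`. -/
theorem kernelHorocyclic_horocyclicLevel {z : ℂ} (hz : z.re < 1) (hz0 : z ≠ 0) (k : ℕ) :
    kernelCentered k z (normSq z) * z =
      kernelHorocyclic k z (horocyclicLevel z) * (starRingEnd ℂ) ((1 - z)⁻¹ ^ 2) := by
  have hu := one_sub_ne_zero_of_re_lt_one hz
  set y := (starRingEnd ℂ) z with hy
  have hu' : 1 - y ≠ 0 := by
    intro h
    apply hu
    have := congrArg (starRingEnd ℂ) h
    simpa [hy] using this
  have e1 : (normSq z : ℂ) = z * y := (mul_conj z).symm
  have e2 : (horocyclicLevel z : ℂ) - (1 - z)⁻¹ = (1 - y)⁻¹ := by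
    have := add_conj ((1 - z)⁻¹)
    rw [horocyclicLevel, ← this]
    simp [hy]
  have n1 : (1 - I) * (1 - y)⁻¹ - 1 = (y - I) * (1 - y)⁻¹ := by field_simp; ring
  have n2 : (1 + I) * (1 - y)⁻¹ - 1 = (y + I) * (1 - y)⁻¹ := by field_simp; ring
  rw [kernelCentered, kernelHorocyclic, e1, e2, n1, n2,
    show z * y - I * z = z * (y - I) by ring, show z * y + I * z = z * (y + I) by ring,
    map_pow, map_inv₀, map_sub, map_one, ← hy]
  simp only [mul_pow, inv_pow]
  -- At the pole `conj z = -i` both sides are `0` by the convention for division by zero.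
  rcases eq_or_ne (y + I) 0 with h | h
  · simp [h]
  · field_simp
    ring

/-- The disc of radius `ρ` tangent at `1` meets the real axis in `[1 - 2ρ, 1]`, so this half-plane
lies to its left. -/
theorem horocyclicLevel_lt_inv {z : ℂ} {ρ : ℝ} (hρ : 0 < ρ) (hz : z.re < 1 - 2 * ρ) :
    horocyclicLevel z < ρ⁻¹ := by
  have hz1 : z.re < 1 := by linarith
  have h0 := normSq_pos.2 (one_sub_ne_zero_of_re_lt_one hz1)
  rw [horocyclicLevel_eq, div_lt_iff₀ h0, inv_mul_eq_div, lt_div_iff₀ hρ]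
  have : (1 - z.re) ^ 2 ≤ normSq (1 - z) := by
    simp [normSq_apply]; nlinarith [mul_self_nonneg z.im]
  nlinarith

theorem sq_lt_normSq {z : ℂ} {r : ℝ} (hr : 0 < r) (hz : r < z.re) : r ^ 2 < normSq z := by
  rw [normSq_apply]; nlinarith [mul_self_nonneg z.im]

theorem continuousOn_div_sqrt (s : Set ℂ) :
    ContinuousOn (Function.uncurry fun (z : ℂ) (t : ℝ) => z / (Real.sqrt t : ℂ)) (s ×ˢ Ioi 0) := by
  refine ContinuousOn.div (by fun_prop) (by fun_prop) ?_
  rintro ⟨z, t⟩ ⟨-, ht⟩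
  exact_mod_cast (Real.sqrt_pos.2 ht).ne'

theorem norm_div_sqrt_le_one {z : ℂ} {t : ℝ} (ht : 0 < t) (h : normSq z ≤ t) :
    ‖z / (Real.sqrt t : ℂ)‖ ≤ 1 := by
  rw [norm_div, norm_real, Real.norm_of_nonneg (Real.sqrt_nonneg t),
    div_le_one (Real.sqrt_pos.2 ht), ← abs_of_nonneg (norm_nonneg z)]
  exact Real.abs_le_sqrt (by rwa [← normSq_eq_norm_sq])

theorem norm_div_sqrt_normSq {z : ℂ} (hz : z ≠ 0) : ‖z / (Real.sqrt (normSq z) : ℂ)‖ = 1 := by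
  have : Real.sqrt (normSq z) = ‖z‖ := rfl
  rw [this, norm_div, norm_real, norm_norm, div_self (norm_ne_zero_iff.2 hz)]

namespace IsExtensionPair

variable {f : ℂ → ℂ} {r ρ : ℝ} {G₁ G₂ : ℝ → ℂ → ℂ}

theorem apply_normSq (h : IsExtensionPair f r ρ G₁ G₂) (hr : 0 < r) {z : ℂ} (hz : r ≤ ‖z‖)
    (hz1 : ‖z‖ ≤ 1) : G₁ (normSq z) (z / (Real.sqrt (normSq z) : ℂ)) = f z := by
  have hz0 : z ≠ 0 := norm_pos_iff.1 (hr.trans_le hz)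
  have hs : (Real.sqrt (normSq z) : ℂ) ≠ 0 := by
    exact_mod_cast (Real.sqrt_pos.2 (normSq_pos.2 hz0)).ne'
  have : normSq z = ‖z‖ ^ 2 := normSq_eq_norm_sq z
  rw [h.bdry₁ _ ⟨by rw [this]; gcongr, by rw [this]; nlinarith [norm_nonneg z]⟩ _
    (by simpa using norm_div_sqrt_normSq hz0), mul_div_cancel₀ _ hs]

theorem apply_horocyclicLevel (h : IsExtensionPair f r ρ G₁ G₂) {z : ℂ} (hz : z.re < 1)
    (h1 : 1 ≤ horocyclicLevel z) (h2 : horocyclicLevel z ≤ ρ⁻¹) :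
    G₂ (horocyclicLevel z) (1 + horocyclicLevel z * (z - 1)) = f z := by
  have hs : (horocyclicLevel z : ℂ) ≠ 0 := by exact_mod_cast (by linarith : horocyclicLevel z ≠ 0)
  rw [h.bdry₂ _ ⟨h1, h2⟩ _ (by simpa using norm_one_add_horocyclicLevel_mul_sub_one hz)]
  congr 1
  field_simp
  ring

/-- The form `F(z, w) (w - i)^k / (w + i)^(k+2) dw` has the same integral along both curves that
join `conj z` to `1 / z` in the lifted families of discs. -/
theorem moments_eq (h : IsExtensionPair f r ρ G₁ G₂) (hr : 0 < r) (hρ : 0 < ρ) {x : ℝ}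
    (hx : r < x) (hx' : x < 1 - 2 * ρ) (k : ℕ) :
    ∫ t in (normSq x)..1, G₁ t (x / (Real.sqrt t : ℂ)) * kernelCentered k x t =
      ∫ t in (horocyclicLevel x)..1, G₂ t (1 + t * (x - 1)) * kernelHorocyclic k x t := by
  -- In the strip, inside the disc, both families have a circle through `z`, and `Im z < 0` keeps
  -- `w` off the pole `-i`. The set `T` below adds the real points and the boundary arc, up to which
  -- both integrals are continuous.
  set V : Set ℂ := {z | r < z.re ∧ z.re < 1 - 2 * ρ ∧ z.im < 0} with hV
  set T : Set ℂ := {z | r < z.re ∧ z.re < 1 - 2 * ρ ∧ z.im ≤ 0 ∧ normSq z ≤ 1} with hT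
  set S : Set ℂ := V ∩ ball 0 1 with hS
  have hVo : IsOpen V := by
    refine IsOpen.and ?_ (IsOpen.and ?_ ?_) <;> exact isOpen_lt (by fun_prop) (by fun_prop)
  have hVc : Convex ℝ V :=
    (convex_halfSpace_re_gt r).inter ((convex_halfSpace_re_lt _).inter (convex_halfSpace_im_lt 0))
  have hSo : IsOpen S := hVo.inter isOpen_ball
  have hS1 : ∀ z ∈ S, normSq z < 1 := fun z hz => by
    rw [normSq_eq_norm_sq, sq_lt_one_iff₀ (norm_nonneg _)]
    simpa using hz.2
  have hST : S ⊆ T := fun z hz => ⟨hz.1.1, hz.1.2.1, hz.1.2.2.le, (hS1 z hz).le⟩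
  have hTre : ∀ z ∈ T, z.re < 1 := fun z hz => by linarith [hz.2.1]
  have hTpos : ∀ z ∈ T, 0 < z.re := fun z hz => hr.trans hz.1
  have hTn : ∀ z ∈ T, r ^ 2 < normSq z := fun z hz => sq_lt_normSq hr hz.1
  have hTl : ∀ z ∈ T, horocyclicLevel z < ρ⁻¹ := fun z hz => horocyclicLevel_lt_inv hρ hz.2.1
  have hTl1 : ∀ z ∈ T, 1 ≤ horocyclicLevel z := fun z hz => by
    rcases hz.2.2.2.lt_or_eq with h | h
    · exact ((one_lt_horocyclicLevel_iff (hTre z hz)).2 h).le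
    · exact ((horocyclicLevel_eq_one_iff (hTre z hz)).2 h).ge
  have hu1 : ∀ z ∈ T, uIcc (normSq z) 1 ⊆ Icc (r ^ 2) 1 := fun z hz => by
    rw [uIcc_of_le hz.2.2.2]
    exact Icc_subset_Icc (hTn z hz).le le_rfl
  have hu2 : ∀ z ∈ T, uIcc (horocyclicLevel z) 1 ⊆ Icc 1 ρ⁻¹ := fun z hz => by
    rw [uIcc_of_ge (hTl1 z hz)]
    exact Icc_subset_Icc le_rfl (hTl z hz).le
  have hJ1 : Icc (r ^ 2) 1 ⊆ Ioi 0 := fun t ht => lt_of_lt_of_le (by positivity) ht.1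
  have hJ2 : Icc 1 ρ⁻¹ ⊆ Ioi (0 : ℝ) := fun t ht => lt_of_lt_of_le one_pos ht.1
  have cζ₁ : ContinuousOn (Function.uncurry fun (z : ℂ) (t : ℝ) => z / (Real.sqrt t : ℂ))
    (T ×ˢ Icc (r ^ 2) 1) := (continuousOn_div_sqrt T).mono (prod_mono Subset.rfl hJ1)
  have cζ₂ : ContinuousOn (Function.uncurry fun (z : ℂ) (t : ℝ) => 1 + t * (z - 1))
    (T ×ˢ Icc 1 ρ⁻¹) := by
    refine Continuous.continuousOn ?_
    simp only [Function.uncurry_def]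
    fun_prop
  have ck₁ : ContinuousOn (Function.uncurry (kernelCentered k)) (T ×ˢ Icc (r ^ 2) 1) :=
    (continuousOn_kernelCentered k).mono (prod_mono (fun z hz => ⟨hTpos z hz, hz.2.2.1⟩) hJ1)
  have ck₂ : ContinuousOn (Function.uncurry (kernelHorocyclic k)) (T ×ˢ Icc 1 ρ⁻¹) :=
    (continuousOn_kernelHorocyclic k).mono
      (prod_mono (fun z hz => ⟨hTre z hz, hz.2.2.1⟩) (subset_univ _))
  set A : ℂ → ℂ := fun z =>
    ∫ t in (normSq z)..1, G₁ t (z / (Real.sqrt t : ℂ)) * kernelCentered k z t with hA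
  set B : ℂ → ℂ := fun z =>
    ∫ t in (horocyclicLevel z)..1, G₂ t (1 + t * (z - 1)) * kernelHorocyclic k z t with hB
  have hAc : ContinuousOn A T := by
    refine continuousOn_intervalIntegral_of_continuousOn_lower
      (h := fun z t => G₁ t (z / (Real.sqrt t : ℂ)) * kernelCentered k z t)
      continuous_normSq.continuousOn ?_
    refine ContinuousOn.mono ?_ (fun q hq => (⟨hq.1, hu1 _ hq.1 hq.2⟩ : q ∈ T ×ˢ Icc (r ^ 2) 1))
    exact (h.cont₁.comp_continuousOn (continuousOn_snd.prodMk cζ₁)).mul ck₁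
  have hBc : ContinuousOn B T := by
    refine continuousOn_intervalIntegral_of_continuousOn_lower
      (h := fun z t => G₂ t (1 + t * (z - 1)) * kernelHorocyclic k z t)
      (fun z hz => (hasFDerivAt_horocyclicLevel (hTre z hz)).continuousAt.continuousWithinAt) ?_
    refine ContinuousOn.mono ?_ (fun q hq => (⟨hq.1, hu2 _ hq.1 hq.2⟩ : q ∈ T ×ˢ Icc 1 ρ⁻¹))
    exact (h.cont₂.comp_continuousOn (continuousOn_snd.prodMk cζ₂)).mul ck₂
  have hd : DifferentiableOn ℂ (fun z => A z - B z) S := by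
    refine differentiableOn_sub_of_wedgeIntegral_eq hSo (hAc.mono hST) (hBc.mono hST)
      fun z w hR => ?_
    have g1 := wedgeIntegral_shrinking_family hSo (b := 1) (J := Icc (r ^ 2) 1)
      (fun z _ => hasFDerivAt_normSq z) (N := fun z => 2 * I * z) (by fun_prop)
      (fun z _ => by
        apply Complex.ext <;> simp)
      (fun z hz => Icc_mem_nhds (hTn z (hST hz)) (hS1 z hz)) (fun z hz => hu1 z (hST hz))
      h.cont₁ h.hol₁ (cζ₁.mono (prod_mono hST Subset.rfl)) (fun t _ => by fun_prop)
      (ck₁.mono (prod_mono hST Subset.rfl))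
      (fun t _ z hz => (differentiableAt_kernelCentered k (hTpos z (hST hz))
        t).differentiableWithinAt)
      (fun z hz t ht => by
        refine norm_div_sqrt_le_one (hJ1 (hu1 z (hST hz) ht)) ?_
        rw [uIcc_of_le (hS1 z hz).le] at ht
        exact ht.1) hR
    have g2 := wedgeIntegral_shrinking_family hSo (b := 1) (J := Icc 1 ρ⁻¹)
      (fun z hz => hasFDerivAt_horocyclicLevel (hTre z (hST hz)))
      (N := fun z => 2 * I * (starRingEnd ℂ) ((1 - z)⁻¹ ^ 2))
      (by
        refine continuousOn_const.mul (continuous_conj.comp_continuousOn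
          (ContinuousOn.pow (ContinuousOn.inv₀ (by fun_prop) fun z hz =>
            one_sub_ne_zero_of_re_lt_one (hTre z (hST hz))) 2)))
      (fun z _ => by
        generalize (1 - z)⁻¹ ^ 2 = u
        apply Complex.ext <;> simp)
      (fun z hz => Icc_mem_nhds ((one_lt_horocyclicLevel_iff (hTre z (hST hz))).2 (hS1 z hz))
        (hTl z (hST hz)))
      (fun z hz => hu2 z (hST hz))
      h.cont₂ h.hol₂ (cζ₂.mono (prod_mono hST Subset.rfl)) (fun t _ => by fun_prop)
      (ck₂.mono (prod_mono hST Subset.rfl))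
      (fun t _ z hz => (differentiableAt_kernelHorocyclic k (hTre z (hST hz)) (hST hz).2.2.1
        t).differentiableWithinAt)
      (fun z hz t ht => by
        refine norm_one_add_mul_sub_one_le_one (hTre z (hST hz)) (hJ2 (hu2 z (hST hz) ht)).le ?_
        rw [uIcc_of_ge (hTl1 z (hST hz))] at ht
        exact ht.2) hR
    rw [g1, g2]
    refine intervalIntegral.integral_congr fun s hs => intervalIntegral.integral_congr fun y hy => ?_
    have hq : (s + y * I : ℂ) ∈ S := hR (by simpa [Rectangle, mem_reProdIm] using And.intro hs hy)
    have hqT := hST hq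
    have hq0 : (s + y * I : ℂ) ≠ 0 := fun h0 => by
      have := hTpos _ hqT
      rw [h0] at this
      simp at this
    have hqn : r ≤ ‖(s + y * I : ℂ)‖ := hqT.1.le.trans (re_le_norm _)
    have hqn1 : ‖(s + y * I : ℂ)‖ ≤ 1 := (mem_ball_zero_iff.1 hq.2).le
    simp only
    rw [h.apply_normSq hr hqn hqn1, h.apply_horocyclicLevel (hTre _ hqT) (hTl1 _ hqT) (hTl _ hqT).le]
    -- At the moving endpoint both extensions equal `f`, so the two Green densities agree.
    linear_combination (-2 * I * f (s + y * I)) *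
      kernelHorocyclic_horocyclicLevel (hTre _ hqT) hq0 k
  have hVT : V ∩ closedBall 0 1 ⊆ T := fun z hz => ⟨hz.1.1, hz.1.2.1, hz.1.2.2.le, by
    rw [normSq_eq_norm_sq, sq_le_one_iff₀ (norm_nonneg _)]; simpa using hz.2⟩
  -- On the unit circle both lower limits equal `1`, the upper limit, so both integrals vanish.
  have hzero := eqOn_zero_of_eqOn_zero_arc hVo hVc ((hAc.sub hBc).mono hVT) hd
    (fun z hz => by
      have hzT := hVT ⟨hz.1, sphere_subset_closedBall hz.2⟩
      have h1 : normSq z = 1 := by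
        rw [normSq_eq_norm_sq, mem_sphere_zero_iff_norm.1 hz.2, one_pow]
      simp [hA, hB, h1, (horocyclicLevel_eq_one_iff (hTre z hzT)).2 h1])
    (by
      have hx0 : 0 < x := hr.trans hx
      refine ⟨⟨x, -Real.sqrt (1 - x ^ 2)⟩, ⟨hx, hx', ?_⟩, ?_⟩
      · simp only [Left.neg_neg_iff]
        exact Real.sqrt_pos.2 (by nlinarith)
      · rw [mem_sphere_zero_iff_norm, ← sq_eq_sq₀ (norm_nonneg _) zero_le_one, ← normSq_eq_norm_sq,
          normSq_apply]
        have := Real.mul_self_sqrt (show 0 ≤ 1 - x ^ 2 by nlinarith)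
        simp only
        nlinarith)
  have hxT : (x : ℂ) ∈ T := ⟨by simpa using hx, by simpa using hx', by simp, by
    rw [normSq_ofReal]; nlinarith⟩
  -- The real point is approached vertically from the lower half-plane.
  have hcl : (x : ℂ) ∈ closure S := by
    have ht : Tendsto (fun s : ℝ => (x - s * I : ℂ)) (𝓝[>] 0) (𝓝 x) := by
      have : Continuous fun s : ℝ => (x - s * I : ℂ) := by fun_prop
      simpa using this.continuousWithinAt.tendsto (s := Ioi 0) (x := 0)
    refine mem_closure_of_tendsto ht ?_
    have hx1 : (x : ℂ) ∈ ball (0 : ℂ) 1 := by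
      have : |x| < 1 := by rw [abs_of_pos (by linarith)]; linarith
      simpa using this
    filter_upwards [self_mem_nhdsWithin, ht (isOpen_ball.mem_nhds hx1)] with s hs hs1
    exact ⟨⟨by simpa using hx, by simpa using hx', by simpa using hs⟩, hs1⟩
  have hfin : A x - B x = 0 := by
    have hc := ((hAc.sub hBc) x hxT).mono hST
    have hne : (𝓝[S] (x : ℂ)).NeBot := mem_closure_iff_nhdsWithin_neBot.1 hcl
    refine tendsto_nhds_unique hc.tendsto (tendsto_const_nhds.congr' ?_)
    filter_upwards [self_mem_nhdsWithin] with z hz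
    exact (hzero z hz).symm
  exact sub_eq_zero.1 hfin

end IsExtensionPair

/-! ### From constancy on the real axis to agreement of all extensions -/

/-- Uniqueness of holomorphic functions on the unit disc from their values on a real interval. -/
theorem eqOn_closedBall_of_eqOn_real_interval {F G : ℂ → ℂ} (hF : DifferentiableOn ℂ F (ball 0 1))
    (hG : DifferentiableOn ℂ G (ball 0 1)) (hFc : ContinuousOn F (closedBall 0 1))
    (hGc : ContinuousOn G (closedBall 0 1)) {a b : ℝ} (hab : a < b) (ha : -1 ≤ a) (hb : b ≤ 1)
    (h : ∀ s ∈ Ioo a b, F s = G s) : EqOn F G (closedBall 0 1) := by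
  set m : ℝ := (a + b) / 2 with hm
  have hmI : m ∈ Ioo a b := ⟨by linarith, by linarith⟩
  have hmem : (m : ℂ) ∈ ball (0 : ℂ) 1 := by
    have : |m| < 1 := abs_lt.2 ⟨by linarith [hmI.1], by linarith [hmI.2]⟩
    simpa using this
  have hball : EqOn F G (ball 0 1) := by
    refine (hF.analyticOnNhd isOpen_ball).eqOn_of_preconnected_of_frequently_eq
      (hG.analyticOnNhd isOpen_ball) (convex_ball _ _).isPreconnected hmem ?_
    have ht : Tendsto (fun s : ℝ => (s : ℂ)) (𝓝[>] m) (𝓝[≠] (m : ℂ)) := by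
      refine tendsto_nhdsWithin_iff.2 ⟨continuous_ofReal.continuousWithinAt.tendsto, ?_⟩
      filter_upwards [self_mem_nhdsWithin] with s hs
      have : s ≠ m := ne_of_gt hs
      simpa using this
    refine ht.frequently (Eventually.frequently ?_)
    filter_upwards [mem_nhdsWithin_of_mem_nhds (Ioo_mem_nhds hmI.1 hmI.2)] with s hs
    exact h s hs
  rw [← closure_ball (0 : ℂ) one_ne_zero] at hFc hGc ⊢
  exact hball.of_subset_closure hFc hGc subset_closure Subset.rfl

theorem horocyclicLevel_ofReal (x : ℝ) : horocyclicLevel x = 2 / (1 - x) := by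
  rw [horocyclicLevel, ← ofReal_one, ← ofReal_sub, ← ofReal_inv, ofReal_re, div_eq_mul_inv]

namespace IsExtensionPair

variable {f : ℂ → ℂ} {r ρ : ℝ} {G₁ G₂ : ℝ → ℂ → ℂ}

theorem eqOn_one (h : IsExtensionPair f r ρ G₁ G₂) (hr : 0 < r) (hr1 : r < 1) (hρ : 0 < ρ)
    (hρ1 : ρ < 1) : EqOn (G₁ 1) (G₂ 1) (closedBall 0 1) := by
  have m1 : (1 : ℝ) ∈ Icc (r ^ 2) 1 := ⟨by nlinarith, le_rfl⟩
  have m2 : (1 : ℝ) ∈ Icc 1 ρ⁻¹ := ⟨le_rfl, (one_le_inv₀ hρ).2 hρ1.le⟩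
  have c1 : Continuous (G₁ 1) := h.cont₁.comp (Continuous.prodMk_right 1)
  have c2 : Continuous (G₂ 1) := h.cont₂.comp (Continuous.prodMk_right 1)
  rw [← closure_ball (0 : ℂ) one_ne_zero]
  refine eqOn_closure_of_eqOn_frontier isBounded_ball ⟨h.hol₁ 1 m1, c1.continuousOn⟩
    ⟨h.hol₂ 1 m2, c2.continuousOn⟩ fun ζ hζ => ?_
  rw [frontier_ball _ one_ne_zero] at hζ
  rw [h.bdry₁ 1 m1 ζ hζ, h.bdry₂ 1 m2 ζ hζ]
  simp

theorem const_on_real (h : IsExtensionPair f r ρ G₁ G₂) (hr : 0 < r) (hρ : 0 < ρ) {x : ℝ}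
    (hx : r < x) (hx' : x < 1 - 2 * ρ) :
    (∀ t ∈ Icc (x ^ 2) 1, G₁ t (x / (Real.sqrt t : ℂ)) = G₁ 1 x) ∧
      ∀ t ∈ Icc 1 (2 / (1 - x)), G₂ t (1 + t * (x - 1)) = G₁ 1 x := by
  have hx0 : 0 < x := hr.trans hx
  have hx1 : x < 1 := by linarith
  have hre : (x : ℂ).re < 1 := by simpa using hx1
  have hn : normSq (x : ℂ) = x ^ 2 := by rw [normSq_ofReal, sq]
  have hl1 : 1 ≤ horocyclicLevel x :=
    ((one_lt_horocyclicLevel_iff hre).2 (by rw [hn]; nlinarith)).le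
  have hl2 : horocyclicLevel x ≤ ρ⁻¹ := (horocyclicLevel_lt_inv hρ (by simpa using hx')).le
  have e1 := h.apply_normSq hr (z := x) (by simpa [abs_of_pos hx0] using hx.le)
    (by simpa [abs_of_pos hx0] using hx1.le)
  have e2 := h.apply_horocyclicLevel hre hl1 hl2
  rw [hn] at e1
  rw [horocyclicLevel_ofReal] at e2
  have m1 := h.moments_eq hr hρ hx hx'
  -- At real `x` the reflected extensions take the conjugate values.
  have m2 := h.conj.moments_eq hr hρ hx hx'
  simp only [hn, horocyclicLevel_ofReal, map_div₀, map_add, map_mul, map_sub, map_one,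
    conj_ofReal] at m1 m2
  have key := eq_const_of_moments_eq_zero hx0 hx1
    (a₁ := fun t => G₁ t (x / (Real.sqrt t : ℂ))) (a₂ := fun t => G₂ t (1 + t * (x - 1)))
    (h.cont₁.comp_continuousOn (continuousOn_id.prodMk
      (ContinuousOn.div (by fun_prop) (by fun_prop) fun t ht => by
        exact_mod_cast (Real.sqrt_pos.2 (lt_of_lt_of_le (by positivity) ht.1)).ne')))
    (h.cont₂.comp (by fun_prop : Continuous fun t : ℝ => (t, 1 + (t : ℂ) * (x - 1)))).continuousOn
    (by
      have := h.eqOn_one hr (by linarith) hρ (by linarith) (x := x)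
        (by simpa [abs_of_pos hx0] using hx1.le)
      simpa using this)
    (e1.trans e2.symm) m1 m2
  simpa using key

/-- In the disc of radius `‖z‖` the extension agrees with `G₁ 1` at the real points `s‖z‖` between
`r` and `1 - 2ρ` with `s < 1`. This is a nonempty interval, so they agree up to the circle, which
contains `z`. -/
theorem eq_of_lt_norm (h : IsExtensionPair f r ρ G₁ G₂) (hr : 0 < r) (hρ : 0 < ρ)
    (hrρ : r < 1 - 2 * ρ) {z : ℂ} (hz : r < ‖z‖) (hz1 : ‖z‖ ≤ 1) : f z = G₁ 1 z := by
  have hR : 0 < ‖z‖ := hr.trans hz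
  have hz0 : z ≠ 0 := norm_pos_iff.1 hR
  have hs : Real.sqrt (normSq z) = ‖z‖ := rfl
  have hn : normSq z = ‖z‖ ^ 2 := normSq_eq_norm_sq z
  have ht : normSq z ∈ Icc (r ^ 2) 1 := ⟨by rw [hn]; gcongr, by rw [hn]; nlinarith⟩
  have m1 : (1 : ℝ) ∈ Icc (r ^ 2) 1 := ⟨by nlinarith, le_rfl⟩
  have c1 : ∀ t, Continuous (G₁ t) := fun t => h.cont₁.comp (Continuous.prodMk_right t)
  have maps : ∀ ζ : ℂ, ‖ζ‖ < 1 → ‖(‖z‖ : ℂ) * ζ‖ < 1 := fun ζ hζ => by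
    rw [norm_mul, norm_real, norm_norm]; nlinarith [norm_nonneg ζ]
  have key : EqOn (G₁ (normSq z)) (fun ζ => G₁ 1 (‖z‖ * ζ)) (closedBall 0 1) := by
    refine eqOn_closedBall_of_eqOn_real_interval (h.hol₁ _ ht)
      ((h.hol₁ 1 m1).comp (by fun_prop) fun ζ hζ => by
        simpa using maps ζ (by simpa using hζ)) (c1 _).continuousOn
      ((c1 1).comp (by fun_prop)).continuousOn (a := r / ‖z‖) (b := min ((1 - 2 * ρ) / ‖z‖) 1)
      ?_ ?_ (min_le_right _ _) ?_
    · exact lt_min (by gcongr) ((div_lt_one hR).2 hz)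
    · exact le_trans (by norm_num) (div_pos hr hR).le
    · rintro s ⟨h1, h2⟩
      have h3 := lt_of_lt_of_le h2 (min_le_left _ _)
      have h4 := lt_of_lt_of_le h2 (min_le_right _ _)
      rw [div_lt_iff₀ hR] at h1
      rw [lt_div_iff₀ hR] at h3
      have hs0 : 0 < s * ‖z‖ := hr.trans h1
      have := (h.const_on_real hr hρ h1 h3).1 (normSq z) ⟨by
        rw [hn]
        gcongr
        nlinarith, ht.2⟩
      rw [hs] at this
      have hRc : (‖z‖ : ℂ) ≠ 0 := by exact_mod_cast hR.ne'
      push_cast at this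
      rw [mul_div_cancel_right₀ _ hRc] at this
      rw [this, mul_comm]
  have hRc : (‖z‖ : ℂ) ≠ 0 := by exact_mod_cast hR.ne'
  have := key (x := z / (Real.sqrt (normSq z) : ℂ)) (by simpa using (norm_div_sqrt_normSq hz0).le)
  rw [h.apply_normSq hr hz.le hz1, hs] at this
  simpa [mul_div_cancel₀ _ hRc] using this

theorem eq_of_horocyclicLevel_lt (h : IsExtensionPair f r ρ G₁ G₂) (hr : 0 < r) (hρ : 0 < ρ)
    (hrρ : r < 1 - 2 * ρ) {z : ℂ} (hz : ‖z‖ < 1) (hz1 : horocyclicLevel z < ρ⁻¹) :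
    f z = G₁ 1 z := by
  have hre : z.re < 1 := (re_le_norm z).trans_lt hz
  set t := horocyclicLevel z with htdef
  have ht1 : 1 < t := (one_lt_horocyclicLevel_iff hre).2 (by
    rw [normSq_eq_norm_sq]; nlinarith [norm_nonneg z])
  have ht0 : 0 < t := by linarith
  have htc : (t : ℂ) ≠ 0 := by exact_mod_cast ht0.ne'
  have m1 : (1 : ℝ) ∈ Icc (r ^ 2) 1 := ⟨by nlinarith, le_rfl⟩
  have c1 : Continuous (G₁ 1) := h.cont₁.comp (Continuous.prodMk_right 1)
  have c2 : Continuous (G₂ t) := h.cont₂.comp (Continuous.prodMk_right t)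
  have htρ : t * ρ < 1 := by
    rwa [lt_inv_comm₀ ht0 hρ, ← one_div, lt_div_iff₀ ht0, mul_comm] at hz1
  have maps : ∀ ζ : ℂ, ‖ζ‖ < 1 → ‖1 + (ζ - 1) / t‖ < 1 := fun ζ hζ => by
    have e : 1 + (ζ - 1) / t = ((1 - t⁻¹ : ℝ) : ℂ) + ((t⁻¹ : ℝ) : ℂ) * ζ := by
      push_cast; field_simp; ring
    have hi : t⁻¹ < 1 := inv_lt_one_of_one_lt₀ ht1
    have hi0 : 0 < t⁻¹ := inv_pos.2 ht0
    rw [e]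
    refine (norm_add_le _ _).trans_lt ?_
    rw [norm_mul, norm_real, norm_real, Real.norm_of_nonneg (by linarith),
      Real.norm_of_nonneg hi0.le]
    nlinarith
  have key : EqOn (G₂ t) (fun ζ => G₁ 1 (1 + (ζ - 1) / t)) (closedBall 0 1) := by
    refine eqOn_closedBall_of_eqOn_real_interval (h.hol₂ _ ⟨ht1.le, hz1.le⟩)
      ((h.hol₁ 1 m1).comp (by fun_prop) fun ζ hζ => by
        simpa using maps ζ (by simpa using hζ)) c2.continuousOn
      -- The bounds are the images of `r` and `1 - 2ρ` under `x ↦ 1 + t (x - 1)`. The cut at `-1`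
      -- keeps `x` in the disc of radius `1 / t`; the interval is nonempty since `t ρ < 1`.
      (c1.comp (by fun_prop)).continuousOn (a := max (1 + t * (r - 1)) (-1))
      (b := 1 + t * (1 - 2 * ρ - 1)) ?_ (le_max_right _ _) (by nlinarith) ?_
    · refine max_lt (by gcongr) (by nlinarith)
    · rintro s ⟨h1, h2⟩
      have h3 := lt_of_le_of_lt (le_max_left _ _) h1
      have h4 := lt_of_le_of_lt (le_max_right _ _) h1
      have hs : s = 1 + t * ((1 + (s - 1) / t) - 1) := by field_simp; ring
      have g1 : r < 1 + (s - 1) / t := by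
        rw [hs] at h3
        nlinarith
      have g2 : 1 + (s - 1) / t < 1 - 2 * ρ := by
        rw [hs] at h2
        nlinarith
      have := (h.const_on_real hr hρ g1 g2).2 t ⟨ht1.le, by
        rw [le_div_iff₀ (by linarith)]
        nlinarith⟩
      push_cast at this ⊢
      rw [← this]
      congr 1
      field_simp
      ring
  have := key (x := 1 + t * (z - 1)) (by
    simpa using (norm_one_add_horocyclicLevel_mul_sub_one hre).le)
  rw [h.apply_horocyclicLevel hre ht1.le hz1.le] at this
  simp only [this]
  rw [add_sub_cancel_left, mul_div_cancel_left₀ _ htc, add_sub_cancel]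

end IsExtensionPair

/-! ### Assembly and rotation to `p = 1` -/

theorem exists_isExtensionPair {f : ℂ → ℂ} {r ρ : ℝ} (hf : ContinuousOn f (closedBall 0 1))
    (hr : 0 < r) (hρ : 0 < ρ)
    (h₁ : ∀ R : ℝ, r ≤ R → R ≤ 1 → ExtendsHolomorphicallyFromCircle f 0 R)
    (h₂ : ∀ R : ℝ, ρ ≤ R → R ≤ 1 → ExtendsHolomorphicallyFromCircle f ((1 - R : ℝ) : ℂ) R) :
    ∃ G₁ G₂ : ℝ → ℂ → ℂ, IsExtensionPair f r ρ G₁ G₂ := by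
  have hpos₁ : ∀ t ∈ Icc (r ^ 2) 1, 0 < Real.sqrt t := fun t ht =>
    Real.sqrt_pos.2 (lt_of_lt_of_le (by positivity) ht.1)
  have hpos₂ : ∀ t ∈ Icc 1 ρ⁻¹, (0 : ℝ) < t := fun t ht => lt_of_lt_of_le one_pos ht.1
  obtain ⟨G₁, c₁, p₁⟩ := exists_continuous_family_of_extendsHolomorphicallyFromCircle hf
    (T := Icc (r ^ 2) 1) isClosed_Icc (c := fun _ => 0) (R := fun t => Real.sqrt t)
    continuousOn_const (by fun_prop) hpos₁
    (fun t ht => (sphere_subset_closedBall).trans (closedBall_subset_closedBall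
      (Real.sqrt_le_one.2 ht.2)))
    (fun t ht => h₁ _ (Real.le_sqrt_of_sq_le ht.1) (Real.sqrt_le_one.2 ht.2))
  obtain ⟨G₂, c₂, p₂⟩ := exists_continuous_family_of_extendsHolomorphicallyFromCircle hf
    (T := Icc 1 ρ⁻¹) isClosed_Icc (c := fun t => ((1 - t⁻¹ : ℝ) : ℂ)) (R := fun t => t⁻¹)
    (continuous_ofReal.comp_continuousOn (continuousOn_const.sub
      (continuousOn_id.inv₀ fun t ht => (hpos₂ t ht).ne')))
    (continuousOn_id.inv₀ fun t ht => (hpos₂ t ht).ne') (fun t ht => inv_pos.2 (hpos₂ t ht))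
    (fun t ht => by
      refine (sphere_subset_closedBall).trans (closedBall_subset_closedBall' ?_)
      rw [dist_zero_right, norm_real, Real.norm_of_nonneg (by
        linarith [inv_le_one_of_one_le₀ ht.1])]
      linarith)
    (fun t ht => h₂ _ ((le_inv_comm₀ hρ (hpos₂ t ht)).2 ht.2) (inv_le_one_of_one_le₀ ht.1))
  refine ⟨G₁, G₂, c₁, c₂, fun t ht => (p₁ t ht).1, fun t ht => (p₂ t ht).1, fun t ht ζ hζ => ?_,
    fun t ht ζ hζ => ?_⟩
  · rw [(p₁ t ht).2 ζ hζ, zero_add]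
  · rw [(p₂ t ht).2 ζ hζ]
    congr 1
    have : (t : ℂ) ≠ 0 := by exact_mod_cast (hpos₂ t ht).ne'
    push_cast
    field_simp
    ring

theorem differentiableOn_of_extends_concentric_and_tangent {f : ℂ → ℂ} {r ρ : ℝ}
    (hf : ContinuousOn f (closedBall 0 1)) (hr : 0 < r) (hρ : 0 < ρ) (hrρ : r < 1 - 2 * ρ)
    (h₁ : ∀ R : ℝ, r ≤ R → R ≤ 1 → ExtendsHolomorphicallyFromCircle f 0 R)
    (h₂ : ∀ R : ℝ, ρ ≤ R → R ≤ 1 → ExtendsHolomorphicallyFromCircle f ((1 - R : ℝ) : ℂ) R) :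
    DifferentiableOn ℂ f (ball 0 1) := by
  obtain ⟨G₁, G₂, h⟩ := exists_isExtensionPair hf hr hρ h₁ h₂
  refine (h.hol₁ 1 ⟨by nlinarith, le_rfl⟩).congr fun z hz => ?_
  rw [mem_ball_zero_iff] at hz
  -- Points with `‖z‖ ≤ r` have `Re z < 1 - 2ρ`, so a circle of the tangent family passes through
  -- them.
  rcases lt_or_ge r ‖z‖ with hzr | hzr
  · exact h.eq_of_lt_norm hr hρ hrρ hzr hz.le
  · exact h.eq_of_horocyclicLevel_lt hr hρ hrρ hz
      (horocyclicLevel_lt_inv hρ (((re_le_norm z).trans hzr).trans_lt hrρ))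

theorem ExtendsHolomorphicallyFromCircle.comp_mul_left {f : ℂ → ℂ} {p a : ℂ} {R : ℝ}
    (hp : ‖p‖ = 1) (h : ExtendsHolomorphicallyFromCircle f (p * a) R) :
    ExtendsHolomorphicallyFromCircle (fun z => f (p * z)) a R := by
  obtain ⟨g, hgc, hgd, hgf⟩ := h
  have hd : ∀ z, dist (p * z) (p * a) = dist z a := fun z => by
    rw [dist_eq_norm, ← mul_sub, norm_mul, hp, one_mul, dist_eq_norm]
  exact ⟨fun z => g (p * z), hgc.comp (by fun_prop) fun z hz => by rwa [mem_closedBall, hd],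
    hgd.comp (by fun_prop) fun z hz => by rwa [mem_ball, hd],
    fun z hz => hgf (by rwa [mem_sphere, hd])⟩

theorem theorem5p1 (f : ℂ → ℂ) (p : ℂ) (r ρ : ℝ)
    (hf : ContinuousOn f (Metric.closedBall (0 : ℂ) 1))
    (hp : p ∈ Metric.sphere (0 : ℂ) 1)
    (hr0 : 0 < r) (hr1 : r < 1) (hρ0 : 0 < ρ) (hρ1 : ρ < 1)
    -- extension from the circles centered at the origin
    (hcentered : ∀ R : ℝ, r ≤ R → R ≤ 1 → ExtendsHolomorphicallyFromCircle f 0 R)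
    -- extension from the circles through `p` that lie in the closed unit disc
    (hthrough : ∀ (a : ℂ) (R : ℝ), ρ ≤ R → R ≤ 1 → p ∈ Metric.sphere a R →
      Metric.sphere a R ⊆ Metric.closedBall (0 : ℂ) 1 → ExtendsHolomorphicallyFromCircle f a R)
    -- the closed discs bounded by the smallest circles of the two families are disjoint; the only
    -- circle of radius `ρ` through `p` in the closed unit disc has center `(1 - ρ) * p`
    (hdisj : Disjoint (Metric.closedBall (0 : ℂ) r)
      (Metric.closedBall ((1 - (ρ : ℂ)) * p) ρ)) :
    DifferentiableOn ℂ f (Metric.ball (0 : ℂ) 1) := by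
  rw [mem_sphere_zero_iff_norm] at hp
  have hp0 : p ≠ 0 := norm_pos_iff.1 (by rw [hp]; exact one_pos)
  have hrρ : r < 1 - 2 * ρ := by
    by_contra hle
    rw [not_lt] at hle
    -- If `r ≥ 1 - 2ρ`, this is a common point: the point of the tangent disc on the ray through `p`
    -- that is closest to the origin.
    have h1 : ((max (1 - 2 * ρ) 0 : ℝ) : ℂ) * p ∈ closedBall (0 : ℂ) r := by
      rw [mem_closedBall_zero_iff, norm_mul, hp, mul_one, norm_real,
        Real.norm_of_nonneg (le_max_right _ _)]
      exact max_le hle hr0.le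
    have h2 : ((max (1 - 2 * ρ) 0 : ℝ) : ℂ) * p ∈ closedBall ((1 - (ρ : ℂ)) * p) ρ := by
      rw [mem_closedBall, dist_eq_norm, ← sub_mul, norm_mul, hp, mul_one, ← ofReal_one,
        ← ofReal_sub, ← ofReal_sub, norm_real, Real.norm_eq_abs, abs_le]
      rcases max_cases (1 - 2 * ρ) 0 with ⟨h, h'⟩ | ⟨h, h'⟩ <;> rw [h] <;>
        constructor <;> linarith
    exact Set.disjoint_left.1 hdisj h1 h2
  have hmaps : ∀ z : ℂ, ‖p * z‖ = ‖z‖ := fun z => by rw [norm_mul, hp, one_mul]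
  have key : DifferentiableOn ℂ (fun z => f (p * z)) (ball 0 1) := by
    refine differentiableOn_of_extends_concentric_and_tangent (r := r) (ρ := ρ) ?_ hr0 hρ0 hrρ
      ?_ ?_
    · refine hf.comp (by fun_prop) fun z hz => ?_
      rwa [mem_closedBall_zero_iff, hmaps, ← mem_closedBall_zero_iff]
    · intro R h1 h2
      exact ExtendsHolomorphicallyFromCircle.comp_mul_left hp (by simpa using hcentered R h1 h2)
    · intro R h1 h2
      refine ExtendsHolomorphicallyFromCircle.comp_mul_left hp (hthrough _ R h1 h2 ?_ ?_)
      · rw [mem_sphere, dist_eq_norm, show p - p * ((1 - R : ℝ) : ℂ) = p * (R : ℂ) by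
          push_cast; ring, hmaps, norm_real, Real.norm_of_nonneg (hρ0.le.trans h1)]
      · refine sphere_subset_closedBall.trans (closedBall_subset_closedBall' ?_)
        rw [dist_zero_right, hmaps, norm_real, Real.norm_of_nonneg (by linarith)]
        linarith
  have hback : DifferentiableOn ℂ (fun z => f (p * (p⁻¹ * z))) (ball 0 1) :=
    key.comp (f := fun z => p⁻¹ * z) (by fun_prop) fun z hz => by
      rwa [mem_ball_zero_iff, norm_mul, norm_inv, hp, inv_one, one_mul, ← mem_ball_zero_iff]
  simpa [mul_inv_cancel_left₀ hp0] using hback
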